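/- For $f:\mathbb{C}\to\mathbb{C}$ let $$Tf(z)=\lim_{\varepsilon\to0^+}\frac1\pi\int_{|\zeta-z|>\varepsilon}\frac{f(\zeta)}{(\zeta-z)^2}\,dm_2(\zeta)$$ denote the Ahlfors–Beurling transform, where $m_2$ is Lebesgue measure on $\mathbb{C}$. Let $2\le p<\infty$, let $p'=p/(p-1)$, and write $\|\cdot\|_p$ for the norm of $L^p(\mathbb{C},m_2)$. 1) For every real-valued $f\in L^p(\mathbb{C})$ the truncated integrals converge absolutely and the limit $Tf(z)$ exists for almost every $z\in\mathbb{C}$, $Tf$ belongs to $L^p(\mathbb{C})$, and $$\|Tf\|_p\le\sqrt2\,(p-1)\,\|f\|_p .$$ That is, $\|T:L^p_{real}\to L^p\|\le\sqrt2\,(p-1)$. 2) For all real-valued $f\in L^p(\mathbb{C})$ and $g\in L^{p'}(\mathbb{C})$ the function $Tf\cdot g$ is integrable and $$\left|\int_{\mathbb{C}}Tf\cdot g\,dm_2\right|\le(p-1)\,\|f\|_p\,\|g\|_{p'} .$$ -/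

import Mathlib

open MeasureTheory Filter Topology

/-- The truncated integral `(1/π) ∫_{|ζ - z| > ε} f(ζ) / (ζ - z)² dm₂(ζ)`, where `m₂` is
Lebesgue measure on the plane. -/
noncomputable def ahlforsBeurlingTrunc (f : ℂ → ℂ) (ε : ℝ) (z : ℂ) : ℂ :=
  (1 / (Real.pi : ℂ)) * ∫ ζ in {ζ : ℂ | ε < ‖ζ - z‖}, f ζ / (ζ - z) ^ 2

/-- The Ahlfors–Beurling transform
`Tf(z) = p.v. (1/π) ∫ f(ζ) / (ζ - z)² dm₂(ζ)`, the limit of the truncated integrals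
as `ε → 0+`. The value is meaningful at the points where `AhlforsBeurlingExistsAt f z` holds. -/
noncomputable def ahlforsBeurling (f : ℂ → ℂ) (z : ℂ) : ℂ :=
  limUnder (𝓝[>] (0 : ℝ)) (fun ε => ahlforsBeurlingTrunc f ε z)

/-- The principal value defining `Tf(z)` exists: all truncated integrals converge absolutely, and
they have a limit as `ε → 0+`. -/
def AhlforsBeurlingExistsAt (f : ℂ → ℂ) (z : ℂ) : Prop :=
  (∀ ε : ℝ, 0 < ε →
    IntegrableOn (fun ζ : ℂ => f ζ / (ζ - z) ^ 2) {ζ : ℂ | ε < ‖ζ - z‖}) ∧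
  ∃ w : ℂ, Tendsto (fun ε => ahlforsBeurlingTrunc f ε z) (𝓝[>] (0 : ℝ)) (𝓝 w)

open scoped FourierTransform SchwartzMap ENNReal NNReal LineDeriv

/-! Everything follows from a directional estimate: for real `f` and every `u` with `|u| = 1`, the
function `Re(u·Tf)` has `L^p` norm at most `(p-1)‖f‖_p`.

On the Fourier side `T` is multiplication by `m(ξ) = -ξ̄/ξ`. If `θ² = -u`, then `Re(u·m(ξ)) =
(⟨θ,ξ⟩² - ⟨iθ,ξ⟩²)/|ξ|²`. This is the limiting symbol of an averaged martingale transform: follow a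
random walk with small steps alternately `±hθ` and `±h·iθ`, multiply the martingale increments of
the first kind by `1` and of the second by `-1`, and average over the paths ending at a point
(`tendsto_walkSymbol`). Burkholder's function is concave along the lines of slope `±1`, is
nonpositive on the diagonal, and up to a constant dominates `|y|^p - (p-1)^p|x|^p`. Hence each such
transform has norm at most `p-1` on `L^p` (`eLpNorm_walkTransform_le`), and Fatou's lemma carries
the bound to the limit (`directional_bound`).

The principal value is tied to the multiplier by a potential equal to `w/ε²` inside the disc of
radius `ε` and to `1/w̄` outside. Its `∂` derivative is a multiple of the disc indicator and its
`∂̄` derivative a multiple of the conjugate truncated kernel. Consequently the truncated transform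
of `f` at `z` is exactly the average of `Tf` over the disc of radius `ε` about `z`
(`ahlforsBeurlingTrunc_eq_average`). Lebesgue differentiation then gives convergence almost
everywhere, without any maximal inequality for the truncations. Cutoffs to balls extend this from
`L²` to `L^p` (`exists_beurling_transform`).

The factor `√2` is the cost of combining `Re Tf` and `Im Tf`. In the bilinear estimate it
disappears: a rotation `u` makes the integral nonnegative, and only `Re(u·Tf)` is paired with the
real function `g`. -/

/-! ### Zigzag concavity of Burkholder's function. -/

/-- Burkholder's function for exponents `p ≥ 2`, without its normalizing constant. -/
noncomputable def burkholder (p x y : ℝ) : ℝ := (|y| - (p - 1) * |x|) * (|x| + |y|) ^ (p - 1)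

/-- The slope of Burkholder's function along the line `t ↦ (t, t + c)`. -/
noncomputable def burkholderSlope (p c t : ℝ) : ℝ :=
  p * ((|t| + |t + c|) ^ (p - 2) * (c - 2 * (p - 2) * (if -c ≤ t ∧ t ≤ 0 then 0 else t)))

lemma antitoneOn_rpow_mul_sub {p c : ℝ} (hp : 2 ≤ p) (hc : 0 ≤ c) :
    AntitoneOn (fun t : ℝ => (2 * t + c) ^ (p - 2) * (c - 2 * (p - 2) * t)) (Set.Ici 0) := by
  have h2 : (0 : ℝ) ≤ p - 2 := by linarith
  refine antitoneOn_of_deriv_nonpos (convex_Ici 0) ?_ ?_ ?_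
  · exact (((continuous_const.mul continuous_id).add continuous_const).rpow_const
      (fun _ => Or.inr h2)).continuousOn.mul (by fun_prop)
  · intro t ht
    rw [interior_Ici] at ht
    have ht : 0 < t := ht
    have : 2 * t + c ≠ 0 := by positivity
    exact ((((differentiableAt_id.const_mul 2).add_const c).rpow_const (Or.inl this)).mul
      (by fun_prop)).differentiableWithinAt
  · intro t ht
    rw [interior_Ici] at ht
    have ht : 0 < t := ht
    have hs : 0 < 2 * t + c := by positivity
    have h1 : HasDerivAt (fun t : ℝ => 2 * t + c) 2 t := by
      simpa using ((hasDerivAt_id t).const_mul 2).add_const c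
    have h3 : HasDerivAt (fun t : ℝ => c - 2 * (p - 2) * t) (-(2 * (p - 2))) t := by
      simpa using ((hasDerivAt_id t).const_mul (2 * (p - 2))).const_sub c
    have h4 := (h1.rpow_const (p := p - 2) (Or.inl hs.ne')).mul h3
    rw [show (fun t : ℝ => (2 * t + c) ^ (p - 2) * (c - 2 * (p - 2) * t))
      = (fun t : ℝ => (2 * t + c) ^ (p - 2)) * (fun t : ℝ => (c - 2 * (p - 2) * t)) from rfl,
      h4.deriv]
    have h5 : (2 * t + c) ^ (p - 2) = (2 * t + c) ^ (p - 2 - 1) * (2 * t + c) := by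
      rw [← Real.rpow_add_one hs.ne']; ring_nf
    rw [h5]
    have h6 : 0 ≤ (2 * t + c) ^ (p - 2 - 1) := by positivity
    have : 2 * (p - 2) * (2 * t + c) ^ (p - 2 - 1) * (c - 2 * (p - 2) * t) +
        (2 * t + c) ^ (p - 2 - 1) * (2 * t + c) * -(2 * (p - 2)) =
        -(4 * ((p - 2) * (p - 1) * t * (2 * t + c) ^ (p - 2 - 1))) := by ring
    rw [this]
    have : 0 ≤ (p - 2) * (p - 1) * t * (2 * t + c) ^ (p - 2 - 1) := by
      have : 0 ≤ p - 1 := by linarith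
      positivity
    linarith

/-- For `-c ≤ t ≤ 0` the sum `|t| + |t + c|` is constant, so the slope is constant there. It
decreases on each outer interval, is continuous at `0`, and at `-c` it can only jump downwards, from
`p(2p-3)c^(p-1)` to `p·c^(p-1)`. -/
lemma antitone_burkholderSlope {p c : ℝ} (hp : 2 ≤ p) (hc : 0 ≤ c) :
    Antitone (burkholderSlope p c) := by
  have h2 : (0 : ℝ) ≤ p - 2 := by linarith
  have hmid : ∀ t, -c ≤ t → t ≤ 0 → burkholderSlope p c t = p * (c ^ (p - 2) * c) := by
    intro t h1 h0
    rw [burkholderSlope, if_pos ⟨h1, h0⟩, abs_of_nonpos h0, abs_of_nonneg (by linarith)]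
    ring_nf
  have hright : ∀ t, 0 ≤ t → burkholderSlope p c t =
      p * ((2 * t + c) ^ (p - 2) * (c - 2 * (p - 2) * t)) := by
    intro t h0
    rcases h0.eq_or_lt with rfl | h0
    · rw [hmid 0 (by linarith) le_rfl]; simp
    · rw [burkholderSlope, if_neg (by intro h; linarith [h.2]), abs_of_pos h0,
        abs_of_pos (by linarith)]
      ring_nf
  have hleft : ∀ t, t < -c → burkholderSlope p c t =
      p * ((-2 * t - c) ^ (p - 2) * (c - 2 * (p - 2) * t)) := by
    intro t h0
    rw [burkholderSlope, if_neg (by intro h; linarith [h.1]), abs_of_neg (by linarith),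
      abs_of_neg (by linarith)]
    ring_nf
  have hR : ∀ s t, 0 ≤ s → s ≤ t → burkholderSlope p c t ≤ burkholderSlope p c s := by
    intro s t hs hst
    rw [hright s hs, hright t (hs.trans hst)]
    exact mul_le_mul_of_nonneg_left
      (antitoneOn_rpow_mul_sub hp hc hs (hs.trans hst) hst) (by linarith)
  have hM : ∀ t, -c ≤ t → burkholderSlope p c t ≤ p * (c ^ (p - 2) * c) := by
    intro t ht
    rcases le_total t 0 with h0 | h0
    · exact (hmid t ht h0).le
    · rw [← hmid 0 (by linarith) le_rfl]
      exact hR 0 t le_rfl h0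
  have hL : ∀ s, s < -c → p * (c ^ (p - 2) * c) ≤ burkholderSlope p c s := by
    intro s hs
    rw [hleft s hs]
    have e1 : c ^ (p - 2) ≤ (-2 * s - c) ^ (p - 2) := Real.rpow_le_rpow hc (by linarith) h2
    have e2 : c ≤ c - 2 * (p - 2) * s := by nlinarith
    exact mul_le_mul_of_nonneg_left (mul_le_mul e1 e2 hc ((Real.rpow_nonneg hc _).trans e1))
      (by linarith)
  intro s t hst
  rcases lt_or_ge s (-c) with hs | hs
  · rcases lt_or_ge t (-c) with ht | ht
    · rw [hleft s hs, hleft t ht]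
      have e0 : 0 ≤ c - 2 * (p - 2) * t := by nlinarith
      have e1 : (-2 * t - c) ^ (p - 2) ≤ (-2 * s - c) ^ (p - 2) :=
        Real.rpow_le_rpow (by linarith) (by linarith) h2
      have e2 : c - 2 * (p - 2) * t ≤ c - 2 * (p - 2) * s := by nlinarith
      exact mul_le_mul_of_nonneg_left (mul_le_mul e1 e2 e0
        (Real.rpow_nonneg (by linarith) _)) (by linarith)
    · exact (hM t ht).trans (hL s hs)
  · rcases le_total 0 s with h0 | h0
    · exact hR s t h0 hst
    · rw [hmid s hs h0]
      exact hM t (hs.trans hst)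

lemma continuous_burkholder {p : ℝ} (hp : 2 ≤ p) :
    Continuous fun z : ℝ × ℝ => burkholder p z.1 z.2 := by
  unfold burkholder
  refine Continuous.mul (by fun_prop) ?_
  exact Continuous.rpow_const (by fun_prop) (fun _ => Or.inr (by linarith))

lemma hasDerivAt_burkholder_line {p c t : ℝ} (hc : 0 ≤ c) (h0 : t ≠ 0) (h1 : t ≠ -c) :
    HasDerivAt (fun t => burkholder p t (t + c)) (burkholderSlope p c t) t := by
  -- On each of the three intervals cut out by `-c` and `0` both factors have the form (affine) and
  -- (affine)`^(p-1)`; the last hypothesis is the derivative formula after division by `(k * t +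
  -- m)^(p-2)`.
  have key : ∀ (a b k m : ℝ), 0 < k * t + m →
      (∀ᶠ u in 𝓝 t, |u + c| - (p - 1) * |u| = a * u + b ∧ |u| + |u + c| = k * u + m) →
      p * (c - 2 * (p - 2) * (if -c ≤ t ∧ t ≤ 0 then 0 else t)) =
        a * (k * t + m) + (a * t + b) * (k * (p - 1)) →
      HasDerivAt (fun t => burkholder p t (t + c)) (burkholderSlope p c t) t := by
    intro a b k m hpos hev heq
    have h2 : HasDerivAt (fun t : ℝ => a * t + b) a t := by
      simpa using ((hasDerivAt_id t).const_mul a).add_const b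
    have h3 : HasDerivAt (fun t : ℝ => k * t + m) k t := by
      simpa using ((hasDerivAt_id t).const_mul k).add_const m
    have h4 := h2.mul (h3.rpow_const (p := p - 1) (Or.inl hpos.ne'))
    refine (h4.congr_of_eventuallyEq ?_).congr_deriv ?_
    · filter_upwards [hev] with u hu
      simp only [burkholder, hu.1, hu.2, Pi.mul_apply]
    · have hs := hev.self_of_nhds.2
      rw [burkholderSlope, hs]
      have h5 : (k * t + m) ^ (p - 1) = (k * t + m) ^ (p - 2) * (k * t + m) := by
        rw [← Real.rpow_add_one hpos.ne']; ring_nf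
      rw [h5, show p - 1 - 1 = p - 2 by ring]
      linear_combination -((k * t + m) ^ (p - 2)) * heq
  rcases lt_or_gt_of_ne h0 with h0 | h0
  · rcases lt_or_gt_of_ne h1 with h1 | h1
    · refine key (p - 2) (-c) (-2) (-c) (by linarith) ?_ ?_
      · filter_upwards [Iio_mem_nhds h1, Iio_mem_nhds h0] with u hu hu0
        rw [Set.mem_Iio] at hu hu0
        rw [abs_of_neg hu0, abs_of_neg (by linarith)]
        constructor <;> ring
      · rw [if_neg (by intro h; linarith [h.1])]; ring
    · have hc' : 0 < c := by linarith
      refine key p c 0 c (by linarith) ?_ ?_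
      · filter_upwards [Ioi_mem_nhds h1, Iio_mem_nhds h0] with u hu hu0
        rw [Set.mem_Ioi] at hu
        rw [Set.mem_Iio] at hu0
        rw [abs_of_neg hu0, abs_of_pos (by linarith)]
        constructor <;> ring
      · rw [if_pos ⟨h1.le, h0.le⟩]; ring
  · refine key (2 - p) c 2 c (by linarith) ?_ ?_
    · filter_upwards [Ioi_mem_nhds h0] with u hu0
      rw [Set.mem_Ioi] at hu0
      rw [abs_of_pos hu0, abs_of_pos (by linarith)]
      constructor <;> ring
    · rw [if_neg (by intro h; linarith [h.2])]; ring

/-- The function is continuous across its possible kinks `0` and `-c`, so the fundamental theorem of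
calculus with a countable exceptional set applies. -/
lemma burkholder_line_sub {p c : ℝ} (hp : 2 ≤ p) (hc : 0 ≤ c) (a b : ℝ) :
    burkholder p b (b + c) - burkholder p a (a + c) = ∫ t in a..b, burkholderSlope p c t := by
  refine (MeasureTheory.integral_eq_of_hasDerivAt_off_countable
    (fun t => burkholder p t (t + c)) _ (s := {0, -c}) (Set.to_countable _) ?_ ?_ ?_).symm
  · exact ((continuous_burkholder hp).comp (by fun_prop : Continuous fun t : ℝ =>
      (t, t + c))).continuousOn
  · intro t ht
    have := ht.2
    simp only [Set.mem_insert_iff, Set.mem_singleton_iff, not_or] at this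
    exact hasDerivAt_burkholder_line hc this.1 this.2
  · exact (antitone_burkholderSlope hp hc).intervalIntegrable

lemma burkholder_midpoint_line {p c : ℝ} (hp : 2 ≤ p) (hc : 0 ≤ c) (t : ℝ) {d : ℝ} (hd : 0 ≤ d) :
    burkholder p (t + d) (t + d + c) + burkholder p (t - d) (t - d + c) ≤
      2 * burkholder p t (t + c) := by
  have hanti := antitone_burkholderSlope hp hc
  have h1 : burkholder p (t + d) (t + d + c) - burkholder p t (t + c) ≤
      d * burkholderSlope p c t := by
    rw [burkholder_line_sub hp hc]
    calc ∫ u in t..(t + d), burkholderSlope p c u ≤ ∫ u in t..(t + d), burkholderSlope p c t :=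
          intervalIntegral.integral_mono_on (by linarith) hanti.intervalIntegrable
            intervalIntegrable_const (fun u hu => hanti hu.1)
      _ = _ := by simp
  have h2 : d * burkholderSlope p c t ≤
      burkholder p t (t + c) - burkholder p (t - d) (t - d + c) := by
    rw [burkholder_line_sub hp hc]
    calc _ = ∫ u in (t - d)..t, burkholderSlope p c t := by simp
      _ ≤ ∫ u in (t - d)..t, burkholderSlope p c u :=
          intervalIntegral.integral_mono_on (by linarith) intervalIntegrable_const
            hanti.intervalIntegrable (fun u hu => hanti hu.2)
  linarith

lemma burkholder_neg_neg (p x y : ℝ) : burkholder p (-x) (-y) = burkholder p x y := by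
  simp [burkholder]

lemma burkholder_neg_right (p x y : ℝ) : burkholder p x (-y) = burkholder p x y := by
  simp [burkholder]

/-- Every line of slope `1` is `t ↦ (t, t + c)` with `c ≥ 0`, up to the symmetry `(x, y) ↦ (-x,
-y)`. -/
lemma burkholder_midpoint {p : ℝ} (hp : 2 ≤ p) (x y d : ℝ) :
    burkholder p (x + d) (y + d) + burkholder p (x - d) (y - d) ≤ 2 * burkholder p x y := by
  wlog hd : 0 ≤ d generalizing d
  · have := this (-d) (by linarith)
    simp only [sub_neg_eq_add, ← sub_eq_add_neg] at this
    linarith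
  rcases le_total x y with h | h
  · have := burkholder_midpoint_line hp (sub_nonneg.2 h) x hd
    ring_nf at this ⊢
    linarith
  · have := burkholder_midpoint_line hp (sub_nonneg.2 h) (-x) hd
    rw [show -x + d + (x - y) = -(y - d) by ring, show -x - d + (x - y) = -(y + d) by ring,
      show -x + (x - y) = -y by ring, show -x + d = -(x - d) by ring,
      show -x - d = -(x + d) by ring] at this
    simp only [burkholder_neg_neg] at this
    linarith

/-- Zigzag concavity of Burkholder's function. -/
lemma burkholder_zigzag {p : ℝ} (hp : 2 ≤ p) {ε : ℝ} (hε : ε = 1 ∨ ε = -1) (x y d : ℝ) :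
    burkholder p (x + d) (y + ε * d) + burkholder p (x - d) (y - ε * d) ≤
      2 * burkholder p x y := by
  rcases hε with rfl | rfl
  · simpa using burkholder_midpoint hp x y d
  · have := burkholder_midpoint hp x (-y) d
    rw [← burkholder_neg_right p (x + d), ← burkholder_neg_right p (x - d),
      burkholder_neg_right p x] at this
    convert this using 3 <;> ring

lemma burkholder_diag_nonpos {p : ℝ} (hp : 2 ≤ p) (x : ℝ) : burkholder p x x ≤ 0 := by
  unfold burkholder
  refine mul_nonpos_of_nonpos_of_nonneg ?_ (by positivity)
  nlinarith [abs_nonneg x]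

/-! ### The majorant property. -/

/-- The normalizing constant in Burkholder's majorant. -/
noncomputable def burkholderConst (p : ℝ) : ℝ := p * (1 - 1 / p) ^ (p - 1)

/-- Bernoulli's inequality gives `(1 - 1/p)^(p-1) ≥ 1 - (p-1)/p = 1/p`. -/
lemma one_le_burkholderConst {p : ℝ} (hp : 2 ≤ p) : 1 ≤ burkholderConst p := by
  have hp0 : 0 < p := by linarith
  have h := one_add_mul_self_le_rpow_one_add (s := -(1 / p)) (p := p - 1)
    (by rw [neg_le_neg_iff, div_le_one hp0]; linarith) (by linarith)
  have h2 : 1 + (p - 1) * -(1 / p) = 1 / p := by field_simp; ring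
  rw [h2, ← sub_eq_add_neg] at h
  calc (1 : ℝ) = p * (1 / p) := by field_simp
    _ ≤ _ := by unfold burkholderConst; gcongr

/-- This is the majorization on `|x| + |y| = 1` with `s = |x|`, to which homogeneity reduces the
general case. Both sides vanish at `s = 1/p`, where `|y| = (p-1)|x|`, and the constant is the one
that makes them tangent there. The derivative of the difference is convex, at most `0` at `s = 0`
and zero at `1/p`; hence it is nonpositive before `1/p` and nonnegative after, so the difference has
its minimum `0` at `1/p`. -/
lemma burkholder_majorant_segment {p : ℝ} (hp : 2 ≤ p) {s : ℝ} (hs : s ∈ Set.Icc (0 : ℝ) 1) :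
    (1 - s) ^ p - (p - 1) ^ p * s ^ p ≤ burkholderConst p * (1 - p * s) := by
  have hp0 : 0 < p := by linarith
  set α := burkholderConst p with hα
  set h : ℝ → ℝ := fun s => α * (1 - p * s) - (1 - s) ^ p + (p - 1) ^ p * s ^ p with hh
  set h' : ℝ → ℝ := fun s => -(α * p) + p * (1 - s) ^ (p - 1) + (p - 1) ^ p * (p * s ^ (p - 1))
    with hh'
  have hder : ∀ s, HasDerivAt h (h' s) s := by
    intro s
    have h1 : HasDerivAt (fun s : ℝ => 1 - s) (-1) s := by
      simpa using (hasDerivAt_id s).const_sub 1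
    have h2 : HasDerivAt (fun s : ℝ => α * (1 - p * s)) (α * -p) s := by
      simpa using (((hasDerivAt_id s).const_mul p).const_sub 1).const_mul α
    have h3 := h1.rpow_const (p := p) (Or.inr (by linarith))
    have h4 := (Real.hasDerivAt_rpow_const (x := s) (p := p) (Or.inr (by linarith))).const_mul
      ((p - 1) ^ p)
    refine ((h2.sub h3).add h4).congr_deriv ?_
    simp only [hh']; ring
  have hconv : ConvexOn ℝ (Set.Icc 0 1) h' := by
    have c1 : ConvexOn ℝ (Set.Icc (0 : ℝ) 1) fun s : ℝ => s ^ (p - 1) :=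
      (convexOn_rpow (by linarith)).subset Set.Icc_subset_Ici_self (convex_Icc 0 1)
    have c2 : ConvexOn ℝ (Set.Icc (0 : ℝ) 1) fun s : ℝ => (1 - s) ^ (p - 1) := by
      refine ⟨convex_Icc 0 1, fun x hx y hy a b ha hb hab => ?_⟩
      have := c1.2 (x := 1 - x) ⟨by linarith [hx.2], by linarith [hx.1]⟩ (y := 1 - y)
        ⟨by linarith [hy.2], by linarith [hy.1]⟩ ha hb hab
      simp only [smul_eq_mul] at this ⊢
      convert this using 2
      linear_combination (-1 : ℝ) * hab
    have c3 : ConvexOn ℝ (Set.Icc (0 : ℝ) 1) fun s : ℝ =>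
        (p • (1 - s) ^ (p - 1) + ((p - 1) ^ p * p) • s ^ (p - 1)) + (-(α * p)) :=
      ((c2.smul hp0.le).add (c1.smul (mul_nonneg
        (Real.rpow_nonneg (by linarith) _) hp0.le))).add_const _
    convert c3 using 2
    simp only [hh', smul_eq_mul]; ring
  have hpp : (1 - 1 / p) = (p - 1) / p := by field_simp
  have hk : 0 < p - 1 := by linarith
  have hpm : 1 / p ∈ Set.Icc (0 : ℝ) 1 := ⟨by positivity, by rw [div_le_one hp0]; linarith⟩
  have e1 : ((p - 1) / p) ^ (p - 1) = (p - 1) ^ (p - 1) / p ^ (p - 1) :=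
    Real.div_rpow hk.le hp0.le _
  have e2 : (1 / p) ^ (p - 1) = 1 / p ^ (p - 1) := by
    rw [Real.div_rpow zero_le_one hp0.le, Real.one_rpow]
  have e3 : (p - 1) ^ p = (p - 1) ^ (p - 1) * (p - 1) := by
    rw [← Real.rpow_add_one hk.ne']; ring_nf
  have e4 : p ^ p = p ^ (p - 1) * p := by
    rw [← Real.rpow_add_one hp0.ne']; ring_nf
  have hpos : 0 < p ^ (p - 1) := by positivity
  have hzero : h (1 / p) = 0 := by
    simp only [hh]
    rw [hpp, Real.div_rpow hk.le hp0.le, Real.div_rpow zero_le_one hp0.le, Real.one_rpow]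
    field_simp
    ring
  have hzero' : h' (1 / p) = 0 := by
    simp only [hh', hα, burkholderConst]
    rw [hpp, e1, e2, e3]
    field_simp
    ring
  have hneg : h' 0 ≤ 0 := by
    simp only [hh']
    have := one_le_burkholderConst hp
    rw [Real.zero_rpow (by linarith)]
    simp only [sub_zero, Real.one_rpow]
    nlinarith
  suffices 0 ≤ h s by simp only [hh] at this; linarith
  rw [← hzero]
  have hcont : Continuous h := continuous_iff_continuousAt.2 fun s => (hder s).continuousAt
  rcases le_total s (1 / p) with hsp | hsp
  · refine antitoneOn_of_deriv_nonpos (convex_Icc 0 (1 / p)) hcont.continuousOn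
      (fun s _ => (hder s).differentiableAt.differentiableWithinAt) (fun s hs => ?_)
      ⟨hs.1, hsp⟩ ⟨by positivity, le_rfl⟩ hsp
    rw [(hder s).deriv]
    rw [interior_Icc] at hs
    have := hconv.le_max_of_mem_Icc (x := 0) (y := 1 / p) (z := s) (by simp) hpm
      ⟨hs.1.le, hs.2.le⟩
    rw [hzero', max_eq_right hneg] at this
    exact this
  · refine monotoneOn_of_deriv_nonneg (convex_Icc (1 / p) 1) hcont.continuousOn
      (fun s _ => (hder s).differentiableAt.differentiableWithinAt) (fun s hs => ?_)
      ⟨le_rfl, hpm.2⟩ ⟨hsp, hs.2⟩ hsp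
    rw [(hder s).deriv]
    rw [interior_Icc] at hs
    -- A negative value of `h'` at `s > 1/p`, with `h' 0 ≤ 0`, would by convexity force `h' (1/p) <
    -- 0`.
    by_contra! hlt
    have hs0 : 0 < s := lt_trans (by positivity) hs.1
    have := hconv.2 (show (0 : ℝ) ∈ Set.Icc 0 1 by simp) (show s ∈ Set.Icc 0 1 from ⟨hs0.le, hs.2.le⟩)
      (show 0 ≤ 1 - 1 / p / s by rw [sub_nonneg, div_le_one hs0]; exact hs.1.le)
      (show 0 ≤ 1 / p / s by positivity) (by ring)
    have e : (1 - 1 / p / s) • (0 : ℝ) + (1 / p / s) • s = 1 / p := by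
      simp; field_simp
    rw [e, hzero', smul_eq_mul, smul_eq_mul] at this
    have hb : 0 < 1 / p / s := by positivity
    have ha : 0 ≤ 1 - 1 / p / s := by rw [sub_nonneg, div_le_one hs0]; exact hs.1.le
    nlinarith

/-- Burkholder's function dominates `|y|ᵖ - (p - 1)ᵖ |x|ᵖ`. -/
lemma burkholder_majorant {p : ℝ} (hp : 2 ≤ p) (x y : ℝ) :
    |y| ^ p - (p - 1) ^ p * |x| ^ p ≤ burkholderConst p * burkholder p x y := by
  have hp0 : 0 < p := by linarith
  rcases (add_nonneg (abs_nonneg x) (abs_nonneg y)).eq_or_lt with h | h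
  · have hx : |x| = 0 := le_antisymm (by linarith [abs_nonneg y]) (abs_nonneg x)
    have hy : |y| = 0 := le_antisymm (by linarith [abs_nonneg x]) (abs_nonneg y)
    simp [burkholder, hx, hy, Real.zero_rpow hp0.ne']
  · set r := |x| + |y| with hr
    have hs : |x| / r ∈ Set.Icc (0 : ℝ) 1 := ⟨by positivity, by
      rw [div_le_one h]; linarith [abs_nonneg y]⟩
    have key := burkholder_majorant_segment hp hs
    have e1 : 1 - |x| / r = |y| / r := by field_simp; linarith
    rw [e1, Real.div_rpow (abs_nonneg _) h.le, Real.div_rpow (abs_nonneg _) h.le] at key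
    have e4 : r ^ p = r ^ (p - 1) * r := by
      rw [← Real.rpow_add_one h.ne']; ring_nf
    have hpos : 0 < r ^ (p - 1) := by positivity
    have := mul_le_mul_of_nonneg_right key (Real.rpow_nonneg h.le p)
    have l1 : (|y| ^ p / r ^ p - (p - 1) ^ p * (|x| ^ p / r ^ p)) * r ^ p =
        |y| ^ p - (p - 1) ^ p * |x| ^ p := by
      have : r ^ p ≠ 0 := (Real.rpow_pos_of_pos h p).ne'
      field_simp
    rw [l1] at this
    refine this.trans (le_of_eq ?_)
    rw [burkholder, ← hr, e4]
    field_simp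
    rw [hr]; ring

lemma abs_burkholder_le {p : ℝ} (hp : 2 ≤ p) (x y : ℝ) :
    |burkholder p x y| ≤ (p - 1) * (|x| + |y|) ^ p := by
  have h0 : 0 ≤ |x| + |y| := by positivity
  rw [burkholder, abs_mul, abs_of_nonneg (Real.rpow_nonneg h0 _)]
  have h2 : |(|y| - (p - 1) * |x|)| ≤ (p - 1) * (|x| + |y|) := by
    rw [abs_le]
    constructor <;> nlinarith [abs_nonneg x, abs_nonneg y]
  calc _ ≤ (p - 1) * (|x| + |y|) * (|x| + |y|) ^ (p - 1) := by gcongr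
    _ = (p - 1) * ((|x| + |y|) ^ (1 : ℝ) * (|x| + |y|) ^ (p - 1)) := by
      rw [Real.rpow_one]; ring
    _ = _ := by rw [← Real.rpow_add_of_nonneg h0 zero_le_one (by linarith)]; ring_nf

/-! ### Martingale transforms along random walks. -/

section MartingaleTransform

variable {E : Type*} [AddCommGroup E] [Module ℝ E]

/-- The average of the two translates of `f` by `±v`. -/
noncomputable def symmAvg (v : ℂ) (f : ℂ → E) : ℂ → E :=
  fun x => (2⁻¹ : ℝ) • (f (x + v) + f (x - v))

/-- The average over all paths of the transform, by the signs `ε`, of the martingale that a function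
generates along the random walk whose steps are `±v`, for the pairs `(v, ε)` of the list. The last
step of the walk is the head of the list. -/
noncomputable def walkTransform : List (ℂ × ℝ) → (ℂ → E) → ℂ → E
  | [], f => f
  | s :: L, f => symmAvg s.1 (walkTransform L (symmAvg s.1 f)) +
      s.2 • (f - symmAvg s.1 (symmAvg s.1 f))

end MartingaleTransform

lemma memLp_comp_add_right {E : Type*} [NormedAddCommGroup E] {f : ℂ → E} {p : ENNReal}
    (hf : MemLp f p volume) (v : ℂ) : MemLp (fun x => f (x + v)) p volume :=
  hf.comp_measurePreserving (measurePreserving_add_right volume v)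

lemma memLp_comp_sub_right {E : Type*} [NormedAddCommGroup E] {f : ℂ → E} {p : ENNReal}
    (hf : MemLp f p volume) (v : ℂ) : MemLp (fun x => f (x - v)) p volume :=
  hf.comp_measurePreserving (measurePreserving_sub_right volume v)

lemma MeasureTheory.MemLp.symmAvg {E : Type*} [NormedAddCommGroup E] [NormedSpace ℝ E]
    {f : ℂ → E} {p : ENNReal} (hf : MemLp f p volume) (v : ℂ) :
    MemLp (symmAvg v f) p volume :=
  ((memLp_comp_add_right hf v).add (memLp_comp_sub_right hf v)).const_smul (2⁻¹ : ℝ)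

lemma MeasureTheory.MemLp.walkTransform {E : Type*} [NormedAddCommGroup E] [NormedSpace ℝ E]
    {p : ENNReal} (L : List (ℂ × ℝ)) {f : ℂ → E} (hf : MemLp f p volume) :
    MemLp (walkTransform L f) p volume := by
  induction L generalizing f with
  | nil => exact hf
  | cons s L ih =>
    exact ((ih (hf.symmAvg s.1)).symmAvg s.1).add
      ((hf.sub ((hf.symmAvg s.1).symmAvg s.1)).const_smul s.2)

lemma integrable_burkholder {p : ℝ} (hp : 2 ≤ p) {f g : ℂ → ℝ}
    (hf : MemLp f (ENNReal.ofReal p) volume) (hg : MemLp g (ENNReal.ofReal p) volume) :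
    Integrable (fun x => burkholder p (f x) (g x)) volume := by
  have hp0 : 0 < p := by linarith
  have h1 := (hf.abs.add hg.abs).integrable_norm_rpow (by simpa using hp0) (by simp)
  rw [ENNReal.toReal_ofReal hp0.le] at h1
  refine (h1.const_mul (p - 1)).mono' ?_ ?_
  · exact (continuous_burkholder hp).comp_aestronglyMeasurable
      (hf.aestronglyMeasurable.prodMk hg.aestronglyMeasurable)
  · filter_upwards with x
    rw [Real.norm_eq_abs]
    refine (abs_burkholder_le hp _ _).trans (le_of_eq ?_)
    simp only [Pi.add_apply, Pi.abs_apply, Real.norm_eq_abs]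
    rw [abs_of_nonneg (by positivity : 0 ≤ |f x| + |g x|)]

/-- The index `i` is a path of the walk and `G i x` is the transformed martingale along that path
when it ends at `x`; averaging over paths gives `walkTransform`. Translation invariance of Lebesgue
measure and zigzag concavity show that, after normalization by the number of paths, the integral of
Burkholder's function cannot increase with a step. It starts nonpositive because with no steps the
pair is `(f, f)`, on the diagonal. -/
lemma exists_family_walkTransform {p : ℝ} (hp : 2 ≤ p) (L : List (ℂ × ℝ))
    (hL : ∀ s ∈ L, s.2 = 1 ∨ s.2 = -1) {f : ℂ → ℝ} (hf : MemLp f (ENNReal.ofReal p) volume) :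
    ∃ (ι : Type) (_ : Fintype ι) (_ : Nonempty ι) (G : ι → ℂ → ℝ),
      (∀ i, MemLp (G i) (ENNReal.ofReal p) volume) ∧
      (∀ x, (Fintype.card ι : ℝ) * walkTransform L f x = ∑ i, G i x) ∧
      ∑ i, ∫ x, burkholder p (f x) (G i x) ≤ 0 := by
  induction L generalizing f with
  | nil =>
    refine ⟨Unit, inferInstance, inferInstance, fun _ => f, fun _ => hf, ?_, ?_⟩
    · intro x; simp [walkTransform]
    · simpa using integral_nonpos fun x => burkholder_diag_nonpos hp (f x)
  | cons s L ih =>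
    obtain ⟨v, ε⟩ := s
    have hε : ε = 1 ∨ ε = -1 := hL (v, ε) (by simp)
    set f' := symmAvg v f with hf'def
    have hf' : MemLp f' (ENNReal.ofReal p) volume := hf.symmAvg v
    obtain ⟨ι, _, _, G, hG, hmean, hU⟩ := ih (fun s hs => hL s (by simp [hs])) hf'
    -- A path ending at `x` made its last step from `x - v` or from `x + v`; the martingale there
    -- had the value of `f'`, and its last increment is multiplied by `ε`.
    let Gp : ι → ℂ → ℝ := fun i x => G i (x - v) + ε * (f x - f' (x - v))
    let Gm : ι → ℂ → ℝ := fun i x => G i (x + v) + ε * (f x - f' (x + v))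
    have hGp : ∀ i, MemLp (Gp i) (ENNReal.ofReal p) volume := fun i =>
      (memLp_comp_sub_right (hG i) v).add
        ((hf.sub (memLp_comp_sub_right hf' v)).const_mul ε)
    have hGm : ∀ i, MemLp (Gm i) (ENNReal.ofReal p) volume := fun i =>
      (memLp_comp_add_right (hG i) v).add
        ((hf.sub (memLp_comp_add_right hf' v)).const_mul ε)
    refine ⟨ι ⊕ ι, inferInstance, inferInstance, Sum.elim Gp Gm, ?_, ?_, ?_⟩
    · rintro (i | i)
      exacts [hGp i, hGm i]
    · intro x
      have h1 := hmean (x + v)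
      have h2 := hmean (x - v)
      simp only [Fintype.sum_sum_type, Sum.elim_inl, Sum.elim_inr, Gp, Gm,
        Finset.sum_add_distrib, Fintype.card_sum, walkTransform, Pi.add_apply, Pi.smul_apply,
        Pi.sub_apply, smul_eq_mul, Finset.sum_const, Finset.card_univ, nsmul_eq_mul]
      rw [← h1, ← h2, ← hf'def]
      simp only [symmAvg, smul_eq_mul]
      push_cast
      ring
    · simp only [Fintype.sum_sum_type, Sum.elim_inl, Sum.elim_inr]
      rw [← Finset.sum_add_distrib]
      refine le_trans (Finset.sum_le_sum (g := fun i => 2 * ∫ x, burkholder p (f' x) (G i x)) ?_)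
        (by rw [← Finset.mul_sum]; linarith)
      intro i _
      have ip := integrable_burkholder hp hf (hGp i)
      have im := integrable_burkholder hp hf (hGm i)
      -- Translation gives both continuations of a path the same penultimate point `x`; their
      -- increments there are opposite, as zigzag concavity requires.
      rw [← integral_add_right_eq_self (fun x => burkholder p (f x) (Gp i x)) v,
        ← integral_sub_right_eq_self (fun x => burkholder p (f x) (Gm i x)) v,
        ← integral_add (ip.comp_add_right v) (im.comp_sub_right v), ← integral_const_mul]
      refine integral_mono ((ip.comp_add_right v).add (im.comp_sub_right v))
        ((integrable_burkholder hp hf' (hG i)).const_mul 2) fun x => ?_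
      have h := burkholder_zigzag hp hε (f' x) (G i x) ((f (x + v) - f (x - v)) / 2)
      have e1 : f' x + (f (x + v) - f (x - v)) / 2 = f (x + v) := by
        simp only [hf'def, symmAvg, smul_eq_mul]; ring
      have e2 : f' x - (f (x + v) - f (x - v)) / 2 = f (x - v) := by
        simp only [hf'def, symmAvg, smul_eq_mul]; ring
      rw [e1, e2] at h
      simp only [Gp, Gm, add_sub_cancel_right, sub_add_cancel]
      have e3 : ε * ((f (x + v) - f (x - v)) / 2) = ε * (f (x + v) - f' x) := by
        simp only [hf'def, symmAvg, smul_eq_mul]; ring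
      have e4 : G i x - ε * (f (x + v) - f' x) = G i x + ε * (f (x - v) - f' x) := by
        simp only [hf'def, symmAvg, smul_eq_mul]; ring
      rwa [e3, e4] at h

/-- Burkholder's inequality for the walk transform. -/
lemma eLpNorm_walkTransform_le {p : ℝ} (hp : 2 ≤ p) (L : List (ℂ × ℝ))
    (hL : ∀ s ∈ L, s.2 = 1 ∨ s.2 = -1) {f : ℂ → ℝ} (hf : MemLp f (ENNReal.ofReal p) volume) :
    eLpNorm (walkTransform L f) (ENNReal.ofReal p) volume ≤
      ENNReal.ofReal (p - 1) * eLpNorm f (ENNReal.ofReal p) volume := by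
  have hp0 : 0 < p := by linarith
  have hpne : ENNReal.ofReal p ≠ 0 := by simpa using hp0
  have hint : ∀ {g : ℂ → ℝ}, MemLp g (ENNReal.ofReal p) volume →
      Integrable (fun x => |g x| ^ p) volume := by
    intro g hg
    have := hg.integrable_norm_rpow hpne (by simp)
    rwa [ENNReal.toReal_ofReal hp0.le] at this
  obtain ⟨ι, _, _, G, hG, hmean, hU⟩ := exists_family_walkTransform hp L hL hf
  have hcard : (0 : ℝ) < Fintype.card ι := by exact_mod_cast Fintype.card_pos
  have hA := hf.walkTransform L
  have hα : 0 ≤ burkholderConst p := zero_le_one.trans (one_le_burkholderConst hp)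
  have h1 : ∑ i, (∫ x, |G i x| ^ p) ≤ Fintype.card ι * ((p - 1) ^ p * ∫ x, |f x| ^ p) := by
    have h2 : ∀ i, (∫ x, |G i x| ^ p) - (p - 1) ^ p * (∫ x, |f x| ^ p) ≤
        burkholderConst p * ∫ x, burkholder p (f x) (G i x) := by
      intro i
      rw [← integral_const_mul, ← integral_const_mul,
        ← integral_sub (hint (hG i)) ((hint hf).const_mul _)]
      exact integral_mono ((hint (hG i)).sub ((hint hf).const_mul _))
        ((integrable_burkholder hp hf (hG i)).const_mul _) fun x => burkholder_majorant hp _ _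
    have h3 := Finset.sum_le_sum fun i (_ : i ∈ Finset.univ) => h2 i
    rw [Finset.sum_sub_distrib, ← Finset.mul_sum, ← Finset.mul_sum, Finset.sum_const,
      Finset.card_univ, nsmul_eq_mul] at h3
    nlinarith [mul_nonpos_of_nonneg_of_nonpos hα hU]
  have h2 : (∫ x, |walkTransform L f x| ^ p) ≤ (p - 1) ^ p * ∫ x, |f x| ^ p := by
    -- Jensen's inequality: averaging over the paths does not increase the `p`-th moment.
    have h3 : ∀ x, Fintype.card ι * |walkTransform L f x| ^ p ≤ ∑ i, |G i x| ^ p := by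
      intro x
      have h4 := Real.rpow_arith_mean_le_arith_mean_rpow Finset.univ
        (fun _ : ι => (Fintype.card ι : ℝ)⁻¹) (fun i => |G i x|) (fun _ _ => by positivity)
        (by simp [Finset.card_univ]) (fun _ _ => abs_nonneg _) (by linarith : 1 ≤ p)
      rw [← Finset.mul_sum, ← Finset.mul_sum] at h4
      have h5 : |walkTransform L f x| ≤ (Fintype.card ι : ℝ)⁻¹ * ∑ i, |G i x| := by
        rw [← div_eq_inv_mul, le_div_iff₀ hcard, mul_comm, ← abs_of_pos hcard, ← abs_mul,
          hmean x]
        exact Finset.abs_sum_le_sum_abs _ _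
      have h6 := (Real.rpow_le_rpow (abs_nonneg _) h5 hp0.le).trans h4
      rwa [← div_eq_inv_mul, le_div_iff₀ hcard, mul_comm] at h6
    have h4 := integral_mono ((hint hA).const_mul (Fintype.card ι : ℝ))
      (integrable_finsetSum Finset.univ fun i _ => hint (hG i)) h3
    rw [integral_const_mul, integral_finsetSum _ fun i _ => hint (hG i)] at h4
    exact le_of_mul_le_mul_left (h4.trans h1) hcard
  rw [hA.eLpNorm_eq_integral_rpow_norm hpne (by simp),
    hf.eLpNorm_eq_integral_rpow_norm hpne (by simp), ENNReal.toReal_ofReal hp0.le,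
    ← ENNReal.ofReal_mul (by linarith)]
  refine ENNReal.ofReal_le_ofReal ?_
  have hk : 0 ≤ p - 1 := by linarith
  simp only [Real.norm_eq_abs]
  calc (∫ x, |walkTransform L f x| ^ p) ^ p⁻¹ ≤ ((p - 1) ^ p * ∫ x, |f x| ^ p) ^ p⁻¹ :=
        Real.rpow_le_rpow (integral_nonneg fun x => by positivity) h2 (by positivity)
    _ = _ := by
        rw [Real.mul_rpow (by positivity) (integral_nonneg fun x => by positivity),
          Real.rpow_rpow_inv hk hp0.ne']

/-! ### Fourier symbols of the walk transforms. -/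

/-- The Fourier transform on `L²(ℂ)`. -/
noncomputable def fourierL2 : Lp ℂ 2 (volume : Measure ℂ) ≃ₗᵢ[ℂ] Lp ℂ 2 (volume : Measure ℂ) :=
  Lp.fourierTransformₗᵢ ℂ ℂ

lemma fourierL2_toLp (f : 𝓢(ℂ, ℂ)) : fourierL2 (f.toLp 2 volume) = (𝓕 f).toLp 2 volume :=
  SchwartzMap.toLp_fourier_eq f

lemma fourier_schwartz_comp_add (f : 𝓢(ℂ, ℂ)) (v ξ : ℂ) :
    𝓕 (SchwartzMap.compSubConstCLM ℂ (-v) f) ξ = (Real.fourierChar (inner ℝ v ξ) : ℂ) * 𝓕 f ξ := by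
  rw [SchwartzMap.fourier_coe, SchwartzMap.fourier_coe]
  have h := congrFun (VectorFourier.fourierIntegral_comp_add_right Real.fourierChar volume
    (innerₗ ℂ) (f : ℂ → ℂ) v) ξ
  have e : (SchwartzMap.compSubConstCLM ℂ (-v) f : ℂ → ℂ) = (f : ℂ → ℂ) ∘ fun x => x + v := by
    ext x; simp [SchwartzMap.compSubConstCLM_apply]
  rw [e]
  exact h

lemma memLp_fourierChar_inner (v : ℂ) :
    MemLp (fun ξ : ℂ => (Real.fourierChar (inner ℝ v ξ) : ℂ)) ∞ (volume : Measure ℂ) := by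
  refine memLp_top_of_bound ?_ 1 (Eventually.of_forall fun ξ => (Circle.norm_coe _).le)
  have : Continuous fun ξ : ℂ => (Real.fourierChar (inner ℝ v ξ) : ℂ) :=
    continuous_subtype_val.comp (Real.continuous_fourierChar.comp (by fun_prop))
  exact this.aestronglyMeasurable

lemma continuous_lpSMul (σ : Lp ℂ ∞ (volume : Measure ℂ)) :
    Continuous fun f : Lp ℂ 2 (volume : Measure ℂ) => (σ • f : Lp ℂ 2 (volume : Measure ℂ)) := by
  refine LipschitzWith.continuous (K := ‖σ‖₊) (LipschitzWith.of_dist_le_mul fun f g => ?_)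
  rw [dist_eq_norm, dist_eq_norm]
  have : σ • f - σ • g = (σ • (f - g) : Lp ℂ 2 (volume : Measure ℂ)) := by
    rw [sub_eq_add_neg, sub_eq_add_neg, ← Lp.smul_neg, ← Lp.add_smul]
  rw [this]
  exact Lp.norm_smul_le _ _

/-- Both sides are continuous in `f`, so the identity for Schwartz functions suffices by density. -/
lemma fourier_compMeasurePreserving_add (v : ℂ) (f : Lp ℂ 2 (volume : Measure ℂ)) :
    fourierL2 (Lp.compMeasurePreserving (· + v) (measurePreserving_add_right volume v) f) =
      ((memLp_fourierChar_inner v).toLp _ • fourierL2 f : Lp ℂ 2 (volume : Measure ℂ)) := by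
  refine DenseRange.induction_on (p := fun f : Lp ℂ 2 (volume : Measure ℂ) =>
    fourierL2 (Lp.compMeasurePreserving (· + v) (measurePreserving_add_right volume v) f) =
      ((memLp_fourierChar_inner v).toLp _ • fourierL2 f : Lp ℂ 2 (volume : Measure ℂ)))
    (SchwartzMap.denseRange_toLpCLM (p := 2) ENNReal.ofNat_ne_top) f ?_ ?_
  · refine isClosed_eq ?_ ?_
    · exact fourierL2.continuous.comp
        (Lp.isometry_compMeasurePreserving _).continuous
    · exact (continuous_lpSMul _).comp fourierL2.continuous
  · intro g
    have e : Lp.compMeasurePreserving (· + v) (measurePreserving_add_right volume v)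
        (g.toLp 2 volume) = (SchwartzMap.compSubConstCLM ℂ (-v) g).toLp 2 volume := by
      refine Lp.ext ?_
      filter_upwards [Lp.coeFn_compMeasurePreserving (g.toLp 2 volume)
        (measurePreserving_add_right volume v), (SchwartzMap.compSubConstCLM ℂ (-v) g).coeFn_toLp 2,
        (measurePreserving_add_right volume v).quasiMeasurePreserving.ae (g.coeFn_toLp 2 volume)]
        with x h1 h2 h3
      rw [h1, h2, Function.comp_apply, h3]
      simp [SchwartzMap.compSubConstCLM_apply]
    simp only [SchwartzMap.toLpCLM_apply]
    rw [e, fourierL2_toLp, fourierL2_toLp]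
    refine Lp.ext ?_
    filter_upwards [(𝓕 (SchwartzMap.compSubConstCLM ℂ (-v) g)).coeFn_toLp 2,
      Lp.coeFn_lpSMul (r := 2) ((memLp_fourierChar_inner v).toLp _) ((𝓕 g).toLp 2 volume),
      (memLp_fourierChar_inner v).coeFn_toLp, (𝓕 g).coeFn_toLp 2] with x h1 h2 h3 h4
    rw [h1, h2, Pi.smul_apply', h3, h4, fourier_schwartz_comp_add, smul_eq_mul]

lemma fourier_toLp_comp_add {f : ℂ → ℂ} (hf : MemLp f 2 volume) (v : ℂ) :
    fourierL2 ((memLp_comp_add_right hf v).toLp _) =ᵐ[volume]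
      fun ξ => (Real.fourierChar (inner ℝ v ξ) : ℂ) * fourierL2 (hf.toLp f) ξ := by
  have h := fourier_compMeasurePreserving_add v (hf.toLp f)
  rw [Lp.toLp_compMeasurePreserving] at h
  have h' : fourierL2 ((memLp_comp_add_right hf v).toLp _) =
    ((memLp_fourierChar_inner v).toLp _ • fourierL2 (hf.toLp f) : Lp ℂ 2 (volume : Measure ℂ)) := h
  rw [h']
  filter_upwards [Lp.coeFn_lpSMul (r := 2) ((memLp_fourierChar_inner v).toLp _)
    (fourierL2 (hf.toLp f)), (memLp_fourierChar_inner v).coeFn_toLp] with x h2 h3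
  rw [h2, Pi.smul_apply', h3, smul_eq_mul]

lemma fourier_toLp_symmAvg {f : ℂ → ℂ} (hf : MemLp f 2 volume) (v : ℂ) :
    fourierL2 ((hf.symmAvg v).toLp _) =ᵐ[volume]
      fun ξ => (Real.cos (2 * Real.pi * inner ℝ v ξ) : ℂ) * fourierL2 (hf.toLp f) ξ := by
  have e : (hf.symmAvg v).toLp _ = (2⁻¹ : ℂ) • ((memLp_comp_add_right hf v).toLp _ +
      (memLp_comp_add_right hf (-v)).toLp _) := by
    refine Lp.ext ?_
    rw [← MemLp.toLp_add, ← MemLp.toLp_const_smul]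
    filter_upwards [(hf.symmAvg v).coeFn_toLp, (((memLp_comp_add_right hf v).add
      (memLp_comp_add_right hf (-v))).const_smul (2⁻¹ : ℂ)).coeFn_toLp] with x h1 h2
    rw [h1, h2]
    simp [symmAvg, sub_eq_add_neg, mul_add]
  rw [e, map_smul, map_add]
  filter_upwards [fourier_toLp_comp_add hf v, fourier_toLp_comp_add hf (-v),
    Lp.coeFn_smul (2⁻¹ : ℂ) (fourierL2 ((memLp_comp_add_right hf v).toLp _) +
      fourierL2 ((memLp_comp_add_right hf (-v)).toLp _)),
    Lp.coeFn_add (fourierL2 ((memLp_comp_add_right hf v).toLp _))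
      (fourierL2 ((memLp_comp_add_right hf (-v)).toLp _))] with x h1 h2 h3 h4
  rw [h3, Pi.smul_apply, h4, Pi.add_apply, h1, h2, inner_neg_left, Real.fourierChar_apply,
    Real.fourierChar_apply, Complex.ofReal_cos, Complex.cos, smul_eq_mul]
  push_cast
  rw [show -(2 * (Real.pi : ℂ) * (inner ℝ v x : ℂ)) * Complex.I =
    2 * (Real.pi : ℂ) * -(inner ℝ v x : ℂ) * Complex.I by ring]
  ring

/-- The Fourier symbol of `walkTransform L`. -/
noncomputable def walkSymbol : List (ℂ × ℝ) → ℂ → ℝ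
  | [], _ => 1
  | s :: L, ξ => Real.cos (2 * Real.pi * inner ℝ s.1 ξ) ^ 2 * walkSymbol L ξ +
      s.2 * (1 - Real.cos (2 * Real.pi * inner ℝ s.1 ξ) ^ 2)

lemma fourier_toLp_walkTransform (L : List (ℂ × ℝ)) {f : ℂ → ℂ} (hf : MemLp f 2 volume) :
    fourierL2 ((hf.walkTransform L).toLp _) =ᵐ[volume]
      fun ξ => (walkSymbol L ξ : ℂ) * fourierL2 (hf.toLp f) ξ := by
  induction L generalizing f with
  | nil =>
    simp only [walkSymbol, Complex.ofReal_one, one_mul]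
    rfl
  | cons s L ih =>
    obtain ⟨v, ε⟩ := s
    have h1 := hf.symmAvg v
    have e : (hf.walkTransform ((v, ε) :: L)).toLp _ = ((h1.walkTransform L).symmAvg v).toLp _ +
        (ε : ℂ) • (hf.toLp f - (h1.symmAvg v).toLp _) := by
      rw [← MemLp.toLp_sub, ← MemLp.toLp_const_smul, ← MemLp.toLp_add]
      congr 1
    rw [e, map_add, map_smul,
      map_sub]
    filter_upwards [fourier_toLp_symmAvg (h1.walkTransform L) v, ih h1,
      fourier_toLp_symmAvg h1 v, fourier_toLp_symmAvg hf v,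
      Lp.coeFn_add (fourierL2 (((h1.walkTransform L).symmAvg v).toLp _))
        ((ε : ℂ) • (fourierL2 (hf.toLp f) - fourierL2 ((h1.symmAvg v).toLp _))),
      Lp.coeFn_smul (ε : ℂ) (fourierL2 (hf.toLp f) - fourierL2 ((h1.symmAvg v).toLp _)),
      Lp.coeFn_sub (fourierL2 (hf.toLp f)) (fourierL2 ((h1.symmAvg v).toLp _))]
      with x g1 g2 g3 g4 g5 g6 g7
    rw [g5, Pi.add_apply, g6, Pi.smul_apply, g7, Pi.sub_apply, g1, g2, g3, g4, smul_eq_mul]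
    simp only [walkSymbol]
    push_cast
    ring

/-- Each step replaces the symbol by its convex combination, with weights `cos²` and `sin²`, with a
sign `±1`. -/
lemma abs_walkSymbol_le (L : List (ℂ × ℝ)) (hL : ∀ s ∈ L, s.2 = 1 ∨ s.2 = -1) (ξ : ℂ) :
    |walkSymbol L ξ| ≤ 1 := by
  induction L with
  | nil => simp [walkSymbol]
  | cons s L ih =>
    have h := abs_le.1 (ih fun s hs => hL s (by simp [hs]))
    have hc := Real.cos_sq_le_one (2 * Real.pi * inner ℝ s.1 ξ)
    have hc0 := sq_nonneg (Real.cos (2 * Real.pi * inner ℝ s.1 ξ))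
    simp only [walkSymbol]
    rw [abs_le]
    rcases hL s (by simp) with h1 | h1 <;> rw [h1] <;> constructor <;> nlinarith

/-- The steps of `n` rounds of the walk along `h v` (with sign `1`) and `h w` (with sign `-1`). -/
noncomputable def alternatingSteps (v w : ℂ) (h : ℝ) : ℕ → List (ℂ × ℝ)
  | 0 => []
  | n + 1 => ((h : ℂ) * v, 1) :: ((h : ℂ) * w, -1) :: alternatingSteps v w h n

lemma sign_alternatingSteps (v w : ℂ) (h : ℝ) (n : ℕ) :
    ∀ s ∈ alternatingSteps v w h n, s.2 = 1 ∨ s.2 = -1 := by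
  induction n with
  | zero => simp [alternatingSteps]
  | succ n ih =>
    intro s hs
    simp only [alternatingSteps, List.mem_cons] at hs
    rcases hs with rfl | rfl | hs
    exacts [Or.inl rfl, Or.inr rfl, ih s hs]

/-- One round acts on the symbol by the affine map `s ↦ (1-A)(1-B)s + (A - B + AB)`. The quotient is
its fixed point, the power of `1 - (A + B - AB) = (1-A)(1-B)` is the contraction after `n` rounds,
and the initial value is `1`. -/
lemma walkSymbol_alternatingSteps (v w : ℂ) (h : ℝ) (n : ℕ) (ξ : ℂ) {A B : ℝ}
    (hA : A = Real.sin (2 * Real.pi * (h * inner ℝ v ξ)) ^ 2)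
    (hB : B = Real.sin (2 * Real.pi * (h * inner ℝ w ξ)) ^ 2) (h0 : A + B - A * B ≠ 0) :
    walkSymbol (alternatingSteps v w h n) ξ =
      (A - B + A * B) / (A + B - A * B) + (1 - (A + B - A * B)) ^ n *
        (1 - (A - B + A * B) / (A + B - A * B)) := by
  have hi : ∀ z : ℂ, (inner ℝ ((h : ℂ) * z) ξ : ℝ) = h * inner ℝ z ξ := by
    intro z
    rw [← Complex.real_smul, real_inner_smul_left]
  induction n with
  | zero => simp [alternatingSteps, walkSymbol]
  | succ n ih =>
    simp only [alternatingSteps, walkSymbol, hi, Real.cos_sq', ← hA, ← hB, ih]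
    have : (A - B + A * B) / (A + B - A * B) * (A + B - A * B) = A - B + A * B :=
      div_mul_cancel₀ _ h0
    set q := (A - B + A * B) / (A + B - A * B)
    rw [pow_succ]
    linear_combination -this

lemma tendsto_sin_sq_div_sq (x : ℝ) :
    Tendsto (fun h : ℝ => Real.sin (2 * Real.pi * (h * x)) ^ 2 / h ^ 2) (𝓝[≠] 0)
      (𝓝 ((2 * Real.pi * x) ^ 2)) := by
  have h1 : HasDerivAt (fun h : ℝ => Real.sin (2 * Real.pi * (h * x))) (2 * Real.pi * x) 0 := by
    have h2 : HasDerivAt (fun h : ℝ => 2 * Real.pi * (h * x)) (2 * Real.pi * x) 0 := by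
      simpa using ((hasDerivAt_id (0 : ℝ)).mul_const x).const_mul (2 * Real.pi)
    simpa using h2.sin
  have h3 := (hasDerivAt_iff_tendsto_slope.1 h1).pow 2
  refine h3.congr fun h => ?_
  simp [slope_def_field, div_pow]

/-- With step `h = 1/(k+1)`, `A` and `B` are of order `h²` and `AB` is negligible, so the fixed
point tends to the quotient. The `(k+1)^3` rounds make the number of rounds times `h²` tend to
infinity, which erases the initial value `1`. -/
lemma tendsto_walkSymbol {v w ξ : ℂ} (hξ : (inner ℝ v ξ : ℝ) ^ 2 + (inner ℝ w ξ : ℝ) ^ 2 ≠ 0) :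
    Tendsto (fun k : ℕ => walkSymbol (alternatingSteps v w (1 / ((k : ℝ) + 1)) ((k + 1) ^ 3)) ξ)
      atTop (𝓝 (((inner ℝ v ξ : ℝ) ^ 2 - (inner ℝ w ξ : ℝ) ^ 2) /
        ((inner ℝ v ξ : ℝ) ^ 2 + (inner ℝ w ξ : ℝ) ^ 2))) := by
  set x : ℝ := inner ℝ v ξ with hx
  set y : ℝ := inner ℝ w ξ with hy
  let h : ℕ → ℝ := fun k => 1 / ((k : ℝ) + 1)
  have hpos : ∀ k, 0 < h k := fun k => by positivity
  have hh0 : Tendsto h atTop (𝓝 0) := tendsto_one_div_add_atTop_nhds_zero_nat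
  have hh : Tendsto h atTop (𝓝[≠] 0) :=
    tendsto_nhdsWithin_iff.2 ⟨hh0, Eventually.of_forall fun k => (hpos k).ne'⟩
  let A : ℕ → ℝ := fun k => Real.sin (2 * Real.pi * (h k * x)) ^ 2
  let B : ℕ → ℝ := fun k => Real.sin (2 * Real.pi * (h k * y)) ^ 2
  let c : ℝ := (2 * Real.pi) ^ 2
  have hc : 0 < c := by positivity
  have hA : Tendsto (fun k => A k / h k ^ 2) atTop (𝓝 (c * x ^ 2)) := by
    have := (tendsto_sin_sq_div_sq x).comp hh
    rwa [mul_pow] at this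
  have hB : Tendsto (fun k => B k / h k ^ 2) atTop (𝓝 (c * y ^ 2)) := by
    have := (tendsto_sin_sq_div_sq y).comp hh
    rwa [mul_pow] at this
  have hAB : Tendsto (fun k => A k * B k / h k ^ 2) atTop (𝓝 0) := by
    have := (hA.mul hB).mul (hh0.pow 2)
    simp only [ne_eq, OfNat.ofNat_ne_zero, not_false_eq_true, zero_pow, mul_zero] at this
    refine this.congr fun k => ?_
    have := (hpos k).ne'
    field_simp
  have hN : Tendsto (fun k => (A k - B k + A k * B k) / h k ^ 2) atTop
      (𝓝 (c * (x ^ 2 - y ^ 2))) := by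
    have := (hA.sub hB).add hAB
    rw [add_zero, ← mul_sub] at this
    exact this.congr fun k => by ring
  have hD : Tendsto (fun k => (A k + B k - A k * B k) / h k ^ 2) atTop
      (𝓝 (c * (x ^ 2 + y ^ 2))) := by
    have := (hA.add hB).sub hAB
    rw [sub_zero, ← mul_add] at this
    exact this.congr fun k => by ring
  have hlim : 0 < c * (x ^ 2 + y ^ 2) := by positivity
  have hq : Tendsto (fun k => (A k - B k + A k * B k) / (A k + B k - A k * B k)) atTop
      (𝓝 ((x ^ 2 - y ^ 2) / (x ^ 2 + y ^ 2))) := by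
    have := hN.div hD hlim.ne'
    rw [mul_div_mul_left _ _ hc.ne'] at this
    refine this.congr fun k => ?_
    exact div_div_div_cancel_right₀ (pow_ne_zero 2 (hpos k).ne') _ _
  have hexp : Tendsto (fun k => (1 - (A k + B k - A k * B k)) ^ ((k + 1) ^ 3)) atTop (𝓝 0) := by
    have h1 : Tendsto (fun k : ℕ => ((k : ℝ) + 1) * ((A k + B k - A k * B k) / h k ^ 2)) atTop
        atTop := (tendsto_atTop_add_const_right atTop (1 : ℝ)
          tendsto_natCast_atTop_atTop).atTop_mul_pos hlim hD
    have h2 := Real.tendsto_exp_neg_atTop_nhds_zero.comp h1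
    refine squeeze_zero (fun k => ?_) (fun k => ?_) h2
    · have : 1 - (A k + B k - A k * B k) = (1 - A k) * (1 - B k) := by ring
      rw [this]
      have ha : 0 ≤ 1 - A k := sub_nonneg.2 (Real.sin_sq_le_one _)
      have hb : 0 ≤ 1 - B k := sub_nonneg.2 (Real.sin_sq_le_one _)
      positivity
    · have h3 := Real.add_one_le_exp (-(A k + B k - A k * B k))
      have h4 : 0 ≤ 1 - (A k + B k - A k * B k) := by
        have : 1 - (A k + B k - A k * B k) = (1 - A k) * (1 - B k) := by ring
        rw [this]
        exact mul_nonneg (sub_nonneg.2 (Real.sin_sq_le_one _))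
          (sub_nonneg.2 (Real.sin_sq_le_one _))
      calc (1 - (A k + B k - A k * B k)) ^ ((k + 1) ^ 3)
          ≤ Real.exp (-(A k + B k - A k * B k)) ^ ((k + 1) ^ 3) :=
            pow_le_pow_left₀ h4 (by linarith) _
        _ = _ := by
            rw [← Real.exp_nat_mul, Function.comp_apply]
            congr 1
            simp only [h]
            push_cast
            field_simp
  have hfin : Tendsto (fun k => (A k - B k + A k * B k) / (A k + B k - A k * B k) +
      (1 - (A k + B k - A k * B k)) ^ ((k + 1) ^ 3) *
        (1 - (A k - B k + A k * B k) / (A k + B k - A k * B k))) atTop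
      (𝓝 ((x ^ 2 - y ^ 2) / (x ^ 2 + y ^ 2))) := by
    have := hq.add (hexp.mul (hq.const_sub 1))
    rwa [zero_mul, add_zero] at this
  refine hfin.congr' ?_
  filter_upwards [hD.eventually (lt_mem_nhds hlim)] with k hk
  refine (walkSymbol_alternatingSteps v w (h k) ((k + 1) ^ 3) ξ rfl rfl ?_).symm
  intro h0
  simp only [A, B] at hk
  rw [h0] at hk
  simp at hk

/-! ### The directional estimate, by passage to the limit. -/

lemma tendsto_Lp_of_dominated {E : Type*} [NormedAddCommGroup E] {p : ℝ≥0∞} [hp1 : Fact (1 ≤ p)]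
    (hp : p ≠ ∞) {F : ℕ → Lp E p (volume : Measure ℂ)} {G : Lp E p (volume : Measure ℂ)}
    {b : ℂ → E} (hb : MemLp b p volume) (hbound : ∀ k, ∀ᵐ x, ‖F k x - G x‖ ≤ ‖b x‖)
    (hlim : ∀ᵐ x, Tendsto (fun k => F k x) atTop (𝓝 (G x))) :
    Tendsto F atTop (𝓝 G) := by
  have hp0 : p ≠ 0 := (zero_lt_one.trans_le hp1.out).ne'
  have hpr : 0 < p.toReal := ENNReal.toReal_pos hp0 hp
  rw [Lp.tendsto_Lp_iff_tendsto_eLpNorm']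
  have e : ∀ k, eLpNorm (⇑(F k) - ⇑G) p volume =
      (∫⁻ x, ‖F k x - G x‖ₑ ^ p.toReal) ^ (1 / p.toReal) := fun k =>
    eLpNorm_eq_lintegral_rpow_enorm_toReal hp0 hp
  simp_rw [e]
  have h0 : Tendsto (fun k => ∫⁻ x, ‖F k x - G x‖ₑ ^ p.toReal) atTop (𝓝 (∫⁻ _ : ℂ, 0)) := by
    refine tendsto_lintegral_of_dominated_convergence' (fun x => ‖b x‖ₑ ^ p.toReal) (fun k => ?_)
      (fun k => ?_) ?_ ?_
    · exact ((Lp.aestronglyMeasurable _).sub (Lp.aestronglyMeasurable _)).enorm.pow_const _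
    · filter_upwards [hbound k] with x hx
      gcongr
      exact enorm_le_iff_norm_le.2 hx
    · exact (lintegral_rpow_enorm_lt_top_of_eLpNorm_lt_top hp0 hp hb.2).ne
    · filter_upwards [hlim] with x hx
      have h1 : Tendsto (fun k => ‖F k x - G x‖ₑ) atTop (𝓝 0) := by
        have := (hx.sub_const (G x)).enorm
        simpa using this
      have := h1.ennrpow_const p.toReal
      simpa [hpr] using this
  have := h0.ennrpow_const (1 / p.toReal)
  simpa [hpr] using this

lemma symmAvg_ofReal (v : ℂ) (f : ℂ → ℝ) :
    symmAvg v (fun x => (f x : ℂ)) = fun x => ((symmAvg v f x : ℝ) : ℂ) := by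
  ext x; simp [symmAvg, mul_add]

lemma walkTransform_ofReal (L : List (ℂ × ℝ)) (f : ℂ → ℝ) :
    walkTransform L (fun x => (f x : ℂ)) = fun x => ((walkTransform L f x : ℝ) : ℂ) := by
  induction L generalizing f with
  | nil => rfl
  | cons s L ih =>
    ext x
    simp only [walkTransform, symmAvg_ofReal, ih, Pi.add_apply, Pi.smul_apply, Pi.sub_apply]
    simp

/-- The Fourier symbol of the Ahlfors–Beurling transform. -/
noncomputable def beurlingSymbol (ξ : ℂ) : ℂ := -(starRingEnd ℂ ξ / ξ)

lemma measurable_beurlingSymbol : Measurable beurlingSymbol :=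
  (Complex.continuous_conj.measurable.div measurable_id).neg

lemma norm_beurlingSymbol_le (ξ : ℂ) : ‖beurlingSymbol ξ‖ ≤ 1 := by
  rw [beurlingSymbol, norm_neg, norm_div, Complex.norm_conj]
  exact div_self_le_one _

/-- Since `θ` and `iθ` are orthonormal, the denominator is `|ξ|²`; and `-θ²·m(ξ) = (θ ξ̄)²/|ξ|²`,
the real part of a square being a difference of squares. -/
lemma re_mul_beurlingSymbol (θ ξ : ℂ) (hθ : ‖θ‖ = 1) (hξ : ξ ≠ 0) :
    (-(θ ^ 2) * beurlingSymbol ξ).re =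
      ((inner ℝ θ ξ : ℝ) ^ 2 - (inner ℝ (Complex.I * θ) ξ : ℝ) ^ 2) /
        ((inner ℝ θ ξ : ℝ) ^ 2 + (inner ℝ (Complex.I * θ) ξ : ℝ) ^ 2) ∧
      (inner ℝ θ ξ : ℝ) ^ 2 + (inner ℝ (Complex.I * θ) ξ : ℝ) ^ 2 ≠ 0 := by
  have hθ2 : θ.re ^ 2 + θ.im ^ 2 = 1 := by
    have := Complex.sq_norm θ
    rw [hθ, Complex.normSq_apply] at this
    linarith
  have hn : 0 < ξ.re ^ 2 + ξ.im ^ 2 := by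
    have := Complex.normSq_pos.2 hξ
    rw [Complex.normSq_apply] at this
    linarith
  have hsum : (inner ℝ θ ξ : ℝ) ^ 2 + (inner ℝ (Complex.I * θ) ξ : ℝ) ^ 2 =
      ξ.re ^ 2 + ξ.im ^ 2 := by
    simp only [Complex.inner, map_mul, Complex.conj_I, Complex.mul_re, Complex.mul_im,
      Complex.neg_re, Complex.neg_im, Complex.I_re, Complex.I_im, Complex.conj_re, Complex.conj_im]
    linear_combination (ξ.re ^ 2 + ξ.im ^ 2) * hθ2
  refine ⟨?_, by rw [hsum]; exact hn.ne'⟩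
  rw [hsum, eq_div_iff hn.ne']
  have hb : beurlingSymbol ξ * ((ξ.re ^ 2 + ξ.im ^ 2 : ℝ) : ℂ) = -(starRingEnd ℂ ξ) ^ 2 := by
    have e : ((ξ.re ^ 2 + ξ.im ^ 2 : ℝ) : ℂ) = ξ * starRingEnd ℂ ξ := by
      rw [Complex.mul_conj, Complex.normSq_apply]; congr 1; ring
    rw [e, beurlingSymbol]
    field_simp
  have h1 : (-(θ ^ 2) * beurlingSymbol ξ).re * (ξ.re ^ 2 + ξ.im ^ 2) =
      (θ ^ 2 * (starRingEnd ℂ ξ) ^ 2).re := by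
    rw [← Complex.re_mul_ofReal, mul_assoc, hb]
    ring_nf
  rw [h1]
  simp only [Complex.inner, map_mul, Complex.conj_I, Complex.mul_re, Complex.mul_im, sq,
      Complex.neg_re, Complex.neg_im, Complex.I_re, Complex.I_im, Complex.conj_re, Complex.conj_im]
  ring

/-- The walk transforms of `f` converge to `F` in `L²` by dominated convergence of their symbols.
They are real-valued and obey Burkholder's bound uniformly, and both properties survive almost
everywhere limits. -/
lemma directional_bound {p : ℝ} (hp : 2 ≤ p) {f : ℂ → ℝ}
    (hf : MemLp f (ENNReal.ofReal p) volume)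
    (hf2 : MemLp (fun x => (f x : ℂ)) 2 volume) {u : ℂ} (hu : ‖u‖ = 1)
    {F : Lp ℂ 2 (volume : Measure ℂ)}
    (hF : fourierL2 F =ᵐ[volume]
      fun ξ => ((u * beurlingSymbol ξ).re : ℂ) * fourierL2 (hf2.toLp _) ξ) :
    (∀ᵐ x, (F x).im = 0) ∧
      eLpNorm (fun x => (F x).re) (ENNReal.ofReal p) volume ≤
        ENNReal.ofReal (p - 1) * eLpNorm f (ENNReal.ofReal p) volume := by
  obtain ⟨θ, hθ⟩ := IsAlgClosed.exists_pow_nat_eq (-u) (n := 2) (by norm_num)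
  have hθ1 : ‖θ‖ = 1 := by
    have : ‖θ‖ ^ 2 = 1 := by rw [← norm_pow, hθ, norm_neg, hu]
    exact (pow_eq_one_iff_of_nonneg (norm_nonneg _) two_ne_zero).1 this
  have hθu : u = -(θ ^ 2) := by rw [hθ, neg_neg]
  let L : ℕ → List (ℂ × ℝ) := fun k =>
    alternatingSteps θ (Complex.I * θ) (1 / ((k : ℝ) + 1)) ((k + 1) ^ 3)
  have hL : ∀ k, ∀ s ∈ L k, s.2 = 1 ∨ s.2 = -1 := fun k => sign_alternatingSteps _ _ _ _
  have hconv : Tendsto (fun k => fourierL2 ((hf2.walkTransform (L k)).toLp _)) atTop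
      (𝓝 (fourierL2 F)) := by
    have hft := fun k => fourier_toLp_walkTransform (L k) hf2
    refine tendsto_Lp_of_dominated (by simp) (b := fun x => 2 * fourierL2 (hf2.toLp _) x)
      ((Lp.memLp _).const_mul 2) ?_ ?_
    · intro k
      filter_upwards [hft k, hF] with x h1 h2
      rw [h1, h2, ← sub_mul, norm_mul, norm_mul]
      gcongr
      refine (norm_sub_le _ _).trans ?_
      have h3 := abs_walkSymbol_le (L k) (hL k) x
      have h4 : |(u * beurlingSymbol x).re| ≤ 1 := by
        refine (Complex.abs_re_le_norm _).trans ?_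
        rw [norm_mul, hu, one_mul]
        exact norm_beurlingSymbol_le x
      rw [Complex.norm_real, Complex.norm_real, Real.norm_eq_abs, Real.norm_eq_abs]
      have h5 : ‖(2 : ℂ)‖ = 2 := by simp
      rw [h5]
      linarith
    · have hne : ∀ᵐ x : ℂ, x ≠ 0 := by
        rw [ae_iff]; simp
      filter_upwards [ae_all_iff.2 hft, hF, hne] with x h1 h2 h3
      simp only [h1, h2]
      obtain ⟨e1, e2⟩ := re_mul_beurlingSymbol θ x hθ1 h3
      rw [← hθu] at e1
      rw [e1]
      exact ((Complex.continuous_ofReal.tendsto _).comp (tendsto_walkSymbol e2)).mul_const _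
  have hconv' : Tendsto (fun k => (hf2.walkTransform (L k)).toLp _) atTop (𝓝 F) := by
    have := (fourierL2.symm.continuous.tendsto _).comp hconv
    simpa [Function.comp_def] using this
  -- Convergence in `L²` yields an almost everywhere convergent subsequence, to which Fatou's lemma
  -- in `L^p` applies.
  obtain ⟨ns, -, hns⟩ := (tendstoInMeasure_of_tendsto_Lp hconv').exists_seq_tendsto_ae
  have hns' : ∀ᵐ x, Tendsto (fun k => ((walkTransform (L (ns k)) f x : ℝ) : ℂ)) atTop (𝓝 (F x)) := by
    filter_upwards [hns, ae_all_iff.2 fun k => (hf2.walkTransform (L (ns k))).coeFn_toLp]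
      with x h1 h2
    simp only [h2] at h1
    simpa only [walkTransform_ofReal] using h1
  refine ⟨?_, ?_⟩
  · filter_upwards [hns'] with x hx
    have h1 := (Complex.continuous_im.tendsto _).comp hx
    refine tendsto_nhds_unique h1 ?_
    simp [Function.comp_def]
  · refine (Lp.eLpNorm_lim_le_liminf_eLpNorm (f := fun k => walkTransform (L (ns k)) f)
      (fun k => (hf.walkTransform _).1) _ ?_).trans ?_
    · filter_upwards [hns'] with x hx
      have h1 := (Complex.continuous_re.tendsto _).comp hx
      simpa [Function.comp_def] using h1
    · refine (liminf_le_liminf (Eventually.of_forall fun k =>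
        eLpNorm_walkTransform_le hp (L (ns k)) (hL _) hf)).trans ?_
      simp

/-! ### The potential linking the truncated kernel to the disc indicator. -/

lemma SchwartzMap.exists_lipschitzWith (f : 𝓢(ℂ, ℂ)) : ∃ C, LipschitzWith C f := by
  refine ⟨Real.toNNReal (SchwartzMap.seminorm ℝ 0 1 f),
    lipschitzWith_of_nnnorm_fderiv_le f.differentiable fun x => NNReal.le_toNNReal_of_coe_le ?_⟩
  rw [coe_nnnorm, ← norm_iteratedFDeriv_one]
  exact SchwartzMap.norm_iteratedFDeriv_le_seminorm ℝ f 1 x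

/-- Integration by parts for complex-valued Lipschitz functions. -/
lemma integral_lineDeriv_mul_eq_neg {C D : ℝ≥0} {f g : ℂ → ℂ} (hf : LipschitzWith C f)
    (hg : LipschitzWith D g) (hgc : HasCompactSupport g) (hfi : Integrable f) (v : ℂ) :
    ∫ x, lineDeriv ℝ f x v * g x = -∫ x, f x * lineDeriv ℝ g x v := by
  have hgi : Integrable g := hg.continuous.integrable_of_hasCompactSupport hgc
  have hre : LipschitzWith 1 Complex.re := by
    refine LipschitzWith.of_dist_le_mul fun a b => ?_
    rw [NNReal.coe_one, one_mul, Complex.dist_eq, Real.dist_eq, ← Complex.sub_re]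
    exact Complex.abs_re_le_norm _
  have him : LipschitzWith 1 Complex.im := by
    refine LipschitzWith.of_dist_le_mul fun a b => ?_
    rw [NNReal.coe_one, one_mul, Complex.dist_eq, Real.dist_eq, ← Complex.sub_im]
    exact Complex.abs_im_le_norm _
  -- The real case; the complex one is assembled from the four products of real and imaginary parts,
  -- whose line derivatives exist almost everywhere by Rademacher's theorem.
  have key : ∀ {A B : ℝ≥0} {a b : ℂ → ℝ}, LipschitzWith A a → LipschitzWith B b →
      Integrable a → Integrable b → HasCompactSupport b →
      Integrable (fun x => lineDeriv ℝ a x v * b x) ∧ Integrable (fun x => a x * lineDeriv ℝ b x v)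
        ∧ ∫ x, lineDeriv ℝ a x v * b x = -∫ x, a x * lineDeriv ℝ b x v := by
    intro A B a b ha hb hai hbi hbc
    refine ⟨?_, ?_, ?_⟩
    · exact hbi.bdd_mul (ha.memLp_lineDeriv v).1
        (Eventually.of_forall fun x => norm_lineDeriv_le_of_lipschitz ℝ ha)
    · exact hai.mul_bdd (hb.memLp_lineDeriv v).1
        (Eventually.of_forall fun x => norm_lineDeriv_le_of_lipschitz ℝ hb)
    · rw [ha.integral_lineDeriv_mul_eq hb hbc v, ← integral_neg]
      congr 1 with x
      rw [lineDeriv_neg]; ring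
  have comp : ∀ {A : ℝ≥0} {a : ℂ → ℂ}, LipschitzWith A a → ∀ᵐ x, lineDeriv ℝ a x v =
      ((lineDeriv ℝ (fun y => (a y).re) x v : ℝ) : ℂ) +
        ((lineDeriv ℝ (fun y => (a y).im) x v : ℝ) : ℂ) * Complex.I := by
    intro A a ha
    filter_upwards [ha.ae_differentiableAt] with x hx
    have h := hx.hasFDerivAt
    have h1 := ((Complex.reCLM.hasFDerivAt.comp x h).hasLineDerivAt v).lineDeriv
    have h2 := ((Complex.imCLM.hasFDerivAt.comp x h).hasLineDerivAt v).lineDeriv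
    have h3 := (h.hasLineDerivAt v).lineDeriv
    simp only [Function.comp_def, Complex.reCLM_apply, Complex.imCLM_apply,
      ContinuousLinearMap.comp_apply] at h1 h2
    rw [h1, h2, h3, Complex.re_add_im]
  have cgre : HasCompactSupport fun x => (g x).re := hgc.comp_left (g := Complex.re) rfl
  have cgim : HasCompactSupport fun x => (g x).im := hgc.comp_left (g := Complex.im) rfl
  obtain ⟨a1, b1, e1⟩ := key (hre.comp hf) (hre.comp hg) hfi.re hgi.re cgre
  obtain ⟨a2, b2, e2⟩ := key (him.comp hf) (him.comp hg) hfi.im hgi.im cgim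
  obtain ⟨a3, b3, e3⟩ := key (hre.comp hf) (him.comp hg) hfi.re hgi.im cgim
  obtain ⟨a4, b4, e4⟩ := key (him.comp hf) (hre.comp hg) hfi.im hgi.re cgre
  simp only [Function.comp_def] at a1 a2 a3 a4 b1 b2 b3 b4 e1 e2 e3 e4
  have hl : ∫ x, lineDeriv ℝ f x v * g x =
      ((∫ x, lineDeriv ℝ (fun y => (f y).re) x v * (g x).re) -
        (∫ x, lineDeriv ℝ (fun y => (f y).im) x v * (g x).im) : ℝ) +
      ((∫ x, lineDeriv ℝ (fun y => (f y).re) x v * (g x).im) +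
        (∫ x, lineDeriv ℝ (fun y => (f y).im) x v * (g x).re) : ℝ) * Complex.I := by
    rw [← integral_sub a1 a2, ← integral_add a3 a4, ← integral_complex_ofReal,
      ← integral_complex_ofReal, ← integral_mul_const,
      ← integral_add (a1.sub a2).ofReal ((a3.add a4).ofReal.mul_const _)]
    refine integral_congr_ae ?_
    filter_upwards [comp hf] with x hx
    rw [hx]
    apply Complex.ext <;> simp
  have hr : ∫ x, f x * lineDeriv ℝ g x v =
      ((∫ x, (f x).re * lineDeriv ℝ (fun y => (g y).re) x v) -
        (∫ x, (f x).im * lineDeriv ℝ (fun y => (g y).im) x v) : ℝ) +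
      ((∫ x, (f x).re * lineDeriv ℝ (fun y => (g y).im) x v) +
        (∫ x, (f x).im * lineDeriv ℝ (fun y => (g y).re) x v) : ℝ) * Complex.I := by
    rw [← integral_sub b1 b2, ← integral_add b3 b4, ← integral_complex_ofReal,
      ← integral_complex_ofReal, ← integral_mul_const,
      ← integral_add (b1.sub b2).ofReal ((b3.add b4).ofReal.mul_const _)]
    refine integral_congr_ae ?_
    filter_upwards [comp hg] with x hx
    rw [hx]
    apply Complex.ext <;> simp
  rw [hl, hr, e1, e2, e3, e4]
  push_cast
  ring

/-- The function equal to `w / ε²` for `|w| ≤ ε` and to `1 / conj w` for `|w| ≥ ε`,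
centred at `z`. -/
noncomputable def discPotential (z : ℂ) (ε : ℝ) (ζ : ℂ) : ℂ :=
  (ζ - z) / ((max ε ‖ζ - z‖ ^ 2 : ℝ) : ℂ)

/-- The derivative of `discPotential z ε` in the direction `v`, off the circle `|ζ - z| = ε`. -/
noncomputable def discPotentialDeriv (z : ℂ) (ε : ℝ) (v ζ : ℂ) : ℂ :=
  if ‖ζ - z‖ ≤ ε then v / (ε ^ 2 : ℝ) else -(starRingEnd ℂ v / starRingEnd ℂ (ζ - z) ^ 2)

lemma lipschitzWith_discPotential (z : ℂ) {ε : ℝ} (hε : 0 < ε) :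
    ∃ C, LipschitzWith C (discPotential z ε) := by
  refine ⟨Real.toNNReal (3 / ε ^ 2), LipschitzWith.of_dist_le' fun a b => ?_⟩
  rw [Complex.dist_eq, Complex.dist_eq]
  set x := a - z with hx
  set y := b - z with hy
  have hxy : a - b = x - y := by rw [hx, hy]; ring
  simp only [discPotential, ← hx, ← hy, hxy]
  set r := max ε ‖x‖ with hr
  set s := max ε ‖y‖ with hs
  have hr0 : ε ≤ r := le_max_left _ _
  have hs0 : ε ≤ s := le_max_left _ _
  have hrp : 0 < r := hε.trans_le hr0
  have hsp : 0 < s := hε.trans_le hs0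
  have hxr : ‖x‖ ≤ r := le_max_right _ _
  have hrs : |s - r| ≤ ‖x - y‖ := by
    refine (abs_max_sub_max_le_max _ _ _ _).trans ?_
    rw [sub_self, abs_zero, max_eq_right (abs_nonneg _), norm_sub_rev x y]
    exact abs_norm_sub_norm_le _ _
  have hrc : (r : ℂ) ≠ 0 := by exact_mod_cast hrp.ne'
  have hsc : (s : ℂ) ≠ 0 := by exact_mod_cast hsp.ne'
  have e : x / ((r ^ 2 : ℝ) : ℂ) - y / ((s ^ 2 : ℝ) : ℂ) =
      x * (((s - r) * (s + r) / (r ^ 2 * s ^ 2) : ℝ) : ℂ) + (x - y) * ((1 / s ^ 2 : ℝ) : ℂ) := by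
    push_cast
    field_simp
    ring
  rw [e]
  refine (norm_add_le _ _).trans ?_
  rw [norm_mul, norm_mul, Complex.norm_real, Complex.norm_real, Real.norm_eq_abs, Real.norm_eq_abs,
    abs_div, abs_mul, abs_of_pos (by positivity : 0 < s + r),
    abs_of_pos (by positivity : 0 < r ^ 2 * s ^ 2), abs_of_pos (by positivity : 0 < 1 / s ^ 2)]
  have h1 : ‖x‖ * (|s - r| * (s + r) / (r ^ 2 * s ^ 2)) ≤ ‖x - y‖ * (2 / ε ^ 2) := by
    calc _ ≤ r * (‖x - y‖ * (s + r) / (r ^ 2 * s ^ 2)) := by gcongr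
      _ = ‖x - y‖ * (1 / (r * s) + 1 / (s * s)) := by field_simp
      _ ≤ ‖x - y‖ * (1 / (ε * ε) + 1 / (ε * ε)) := by gcongr
      _ = _ := by ring
  have h2 : ‖x - y‖ * (1 / s ^ 2) ≤ ‖x - y‖ * (1 / ε ^ 2) := by gcongr
  calc _ ≤ ‖x - y‖ * (2 / ε ^ 2) + ‖x - y‖ * (1 / ε ^ 2) := add_le_add h1 h2
    _ = _ := by ring

lemma hasLineDerivAt_discPotential {z ζ : ℂ} {ε : ℝ} (hε : 0 < ε) (h : ‖ζ - z‖ ≠ ε) (v : ℂ) :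
    HasLineDerivAt ℝ (discPotential z ε) (discPotentialDeriv z ε v ζ) ζ v := by
  rcases lt_or_gt_of_ne h with h | h
  · have h1 : HasFDerivAt (fun ζ : ℂ => (ζ - z) / ((ε ^ 2 : ℝ) : ℂ))
        ((ContinuousLinearMap.toSpanSingleton ℂ (1 / ((ε ^ 2 : ℝ) : ℂ))).restrictScalars ℝ) ζ :=
      ((((hasDerivAt_id ζ).sub_const z).div_const _).hasFDerivAt).restrictScalars ℝ
    have h2 : discPotential z ε =ᶠ[𝓝 ζ] fun ζ => (ζ - z) / ((ε ^ 2 : ℝ) : ℂ) := by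
      have : ∀ᶠ y in 𝓝 ζ, ‖y - z‖ < ε :=
        (by fun_prop : Continuous fun y : ℂ => ‖y - z‖).continuousAt.eventually_lt_const h
      filter_upwards [this] with y hy
      rw [discPotential, max_eq_left hy.le]
    have h3 := (h1.congr_of_eventuallyEq h2).hasLineDerivAt v
    rw [discPotentialDeriv, if_pos h.le]
    simpa [div_eq_mul_inv] using h3
  · have hne : ζ - z ≠ 0 := norm_pos_iff.1 (hε.trans h)
    have h1 : HasFDerivAt (fun ζ : ℂ => (ζ - z)⁻¹)
        ((ContinuousLinearMap.toSpanSingleton ℂ (-1 / (ζ - z) ^ 2)).restrictScalars ℝ) ζ :=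
      ((((hasDerivAt_id ζ).sub_const z).fun_inv hne).hasFDerivAt).restrictScalars ℝ
    have h1' := (Complex.conjCLE.toContinuousLinearMap.hasFDerivAt).comp ζ h1
    have h2 : discPotential z ε =ᶠ[𝓝 ζ]
        (⇑Complex.conjCLE.toContinuousLinearMap ∘ fun ζ : ℂ => (ζ - z)⁻¹) := by
      have : ∀ᶠ y in 𝓝 ζ, ε < ‖y - z‖ :=
        (by fun_prop : Continuous fun y : ℂ => ‖y - z‖).continuousAt.eventually_const_lt h
      filter_upwards [this] with y hy
      have hy0 : y - z ≠ 0 := norm_pos_iff.1 (hε.trans hy)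
      have hy1 : starRingEnd ℂ (y - z) ≠ 0 := (map_ne_zero _).2 hy0
      have e : (((‖y - z‖) ^ 2 : ℝ) : ℂ) = (y - z) * starRingEnd ℂ (y - z) := by
        rw [Complex.mul_conj, Complex.normSq_eq_norm_sq]
      rw [discPotential, max_eq_right hy.le, e]
      simp only [Function.comp_apply, ContinuousLinearEquiv.coe_coe, Complex.conjCLE_apply,
        map_inv₀]
      field_simp
    have h3 := (h1'.congr_of_eventuallyEq h2).hasLineDerivAt v
    rw [discPotentialDeriv, if_neg (not_le.2 h)]
    simpa [div_eq_mul_inv] using h3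

lemma ae_norm_sub_ne (z : ℂ) {ε : ℝ} (hε : 0 < ε) : ∀ᵐ ζ : ℂ, ‖ζ - z‖ ≠ ε := by
  have := Measure.addHaar_sphere_of_ne_zero (volume : Measure ℂ) z hε.ne'
  rw [ae_iff]
  convert this using 2
  ext ζ
  simp

/-- The normalized indicator function of the disc of centre `z` and radius `ε`. -/
noncomputable def discAverage (z : ℂ) (ε : ℝ) (ζ : ℂ) : ℂ :=
  if ‖ζ - z‖ ≤ ε then ((1 / (Real.pi * ε ^ 2) : ℝ) : ℂ) else 0

/-- The complex conjugate of the truncated kernel of the Ahlfors–Beurling transform. -/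
noncomputable def conjTruncKernel (z : ℂ) (ε : ℝ) (ζ : ℂ) : ℂ :=
  if ‖ζ - z‖ ≤ ε then 0 else 1 / ((Real.pi : ℂ) * starRingEnd ℂ (ζ - z) ^ 2)

/-- The left side is `2∂` of the potential: it is `2/ε²` inside the disc and zero outside, where
`1/w̄` is antiholomorphic. -/
lemma discPotentialDeriv_sub (z : ℂ) (ε : ℝ) (ζ : ℂ) :
    discPotentialDeriv z ε 1 ζ - Complex.I * discPotentialDeriv z ε Complex.I ζ =
      2 * Real.pi * discAverage z ε ζ := by
  have hpi : (Real.pi : ℂ) ≠ 0 := by exact_mod_cast Real.pi_ne_zero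
  unfold discPotentialDeriv discAverage
  split_ifs
  · rw [← mul_div_assoc, Complex.I_mul_I]
    push_cast
    field_simp
    ring
  · simp only [map_one, Complex.conj_I, mul_neg, mul_zero]
    rw [← mul_div_assoc, mul_neg, Complex.I_mul_I]
    ring

/-- The left side is `2∂̄` of the potential, which vanishes inside the disc, where the potential is
holomorphic. -/
lemma discPotentialDeriv_add (z : ℂ) (ε : ℝ) (ζ : ℂ) :
    discPotentialDeriv z ε 1 ζ + Complex.I * discPotentialDeriv z ε Complex.I ζ =
      -(2 * Real.pi * conjTruncKernel z ε ζ) := by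
  have hpi : (Real.pi : ℂ) ≠ 0 := by exact_mod_cast Real.pi_ne_zero
  unfold discPotentialDeriv conjTruncKernel
  split_ifs
  · rw [← mul_div_assoc, Complex.I_mul_I]
    ring
  · simp only [map_one, Complex.conj_I, mul_neg]
    rw [← mul_div_assoc, mul_neg, Complex.I_mul_I]
    by_cases h : starRingEnd ℂ (ζ - z) = 0
    · simp [h]
    · field_simp
      ring

lemma measurable_conjTruncKernel (z : ℂ) (ε : ℝ) : Measurable (conjTruncKernel z ε) := by
  refine Measurable.ite (measurableSet_le (by fun_prop) measurable_const) measurable_const ?_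
  exact measurable_const.div (measurable_const.mul
    ((Complex.continuous_conj.measurable.comp (by fun_prop)).pow_const 2))

lemma norm_discAverage_le (z : ℂ) {ε : ℝ} (hε : 0 < ε) (ζ : ℂ) :
    ‖discAverage z ε ζ‖ ≤ 1 / (Real.pi * ε ^ 2) := by
  have := Real.pi_pos
  unfold discAverage
  split_ifs
  · rw [Complex.norm_real, Real.norm_eq_abs, abs_of_pos (by positivity)]
  · rw [norm_zero]; positivity

lemma norm_conjTruncKernel_le (z : ℂ) {ε : ℝ} (hε : 0 < ε) (ζ : ℂ) :
    ‖conjTruncKernel z ε ζ‖ ≤ 1 / (Real.pi * ε ^ 2) := by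
  have := Real.pi_pos
  unfold conjTruncKernel
  split_ifs with h
  · rw [norm_zero]; positivity
  · rw [norm_div, norm_mul, norm_pow, Complex.norm_conj, norm_one, Complex.norm_real,
      Real.norm_eq_abs, abs_of_pos Real.pi_pos]
    push Not at h
    gcongr

/-- A single potential decays only like `1/|w|`. The difference of two is compactly supported, since
both equal `1/w̄` far out, and integration by parts applies. -/
lemma integral_lineDeriv_mul_discPotential (g : 𝓢(ℂ, ℂ)) (v z : ℂ) {ε R : ℝ} (hε : 0 < ε)
    (hR : 0 < R) :
    ∫ x, (∂_{v} g) x * (discPotential z ε x - discPotential z R x) =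
      -∫ x, g x * (discPotentialDeriv z ε v x - discPotentialDeriv z R v x) := by
  obtain ⟨C, hC⟩ := g.exists_lipschitzWith
  obtain ⟨D₁, hD₁⟩ := lipschitzWith_discPotential z hε
  obtain ⟨D₂, hD₂⟩ := lipschitzWith_discPotential z hR
  have hsupp : HasCompactSupport fun x => discPotential z ε x - discPotential z R x := by
    refine HasCompactSupport.of_support_subset_isCompact
      (isCompact_closedBall z (max ε R)) fun x hx => ?_
    rw [Metric.mem_closedBall, dist_eq_norm]
    by_contra! h
    rw [max_lt_iff] at h
    refine hx ?_
    simp only [discPotential, max_eq_right h.1.le, max_eq_right h.2.le, sub_self]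
  have h := integral_lineDeriv_mul_eq_neg hC (hD₁.sub hD₂) hsupp g.integrable v
  simp only [← SchwartzMap.lineDerivOp_apply] at h
  rw [h]
  congr 1
  refine integral_congr_ae ?_
  filter_upwards [ae_norm_sub_ne z hε, ae_norm_sub_ne z hR] with x h1 h2
  have h3 : HasLineDerivAt ℝ (fun x => discPotential z ε x - discPotential z R x)
      (discPotentialDeriv z ε v x - discPotentialDeriv z R v x) x v :=
    HasDerivAt.sub (hasLineDerivAt_discPotential hε h1 v) (hasLineDerivAt_discPotential hR h2 v)
  rw [h3.lineDeriv]

lemma hasTemperateGrowth_conj : Function.HasTemperateGrowth (starRingEnd ℂ : ℂ → ℂ) :=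
  Complex.conjCLE.toContinuousLinearMap.hasTemperateGrowth

lemma hasTemperateGrowth_id : Function.HasTemperateGrowth (fun x : ℂ => x) :=
  (ContinuousLinearMap.id ℝ ℂ).hasTemperateGrowth

lemma lineDeriv_one_add_smul_fourier (η : 𝓢(ℂ, ℂ)) (c : ℂ) (σ : ℂ → ℂ)
    (hσ : Function.HasTemperateGrowth σ) (h : ∀ x, σ x = x.re + c * x.im) :
    ∂_{(1 : ℂ)} (𝓕 η) + c • ∂_{Complex.I} (𝓕 η) =
      (-(2 * Real.pi * Complex.I)) • 𝓕 (SchwartzMap.smulLeftCLM ℂ σ η) := by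
  rw [SchwartzMap.lineDerivOp_fourier_eq, SchwartzMap.lineDerivOp_fourier_eq,
    ← FourierTransform.fourier_smul, ← FourierTransform.fourier_smul,
    ← FourierTransform.fourier_add]
  congr 1
  ext x
  have h1 : (fun x : ℂ => (inner ℝ x 1 : ℝ)).HasTemperateGrowth :=
    ((innerSL ℝ).flip (1 : ℂ)).hasTemperateGrowth
  have h2 : (fun x : ℂ => (inner ℝ x Complex.I : ℝ)).HasTemperateGrowth :=
    ((innerSL ℝ).flip Complex.I).hasTemperateGrowth
  simp only [_root_.add_apply, _root_.smul_apply, SchwartzMap.smulLeftCLM_apply_apply hσ,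
    SchwartzMap.smulLeftCLM_apply_apply h1, SchwartzMap.smulLeftCLM_apply_apply h2, h x]
  simp [Complex.inner]
  ring

lemma integrable_mul_bounded (g : 𝓢(ℂ, ℂ)) {k : ℂ → ℂ} (hk : Measurable k) {C : ℝ}
    (hC : ∀ x, ‖k x‖ ≤ C) : Integrable fun x => g x * k x :=
  g.integrable.mul_bdd hk.aestronglyMeasurable (Eventually.of_forall hC)

lemma integrable_mul_discPotentialDeriv (g : 𝓢(ℂ, ℂ)) (v z : ℂ) {ε : ℝ} (hε : 0 < ε) :
    Integrable fun x => g x * discPotentialDeriv z ε v x := by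
  refine integrable_mul_bounded g (k := discPotentialDeriv z ε v) ?_ (C := ‖v‖ / ε ^ 2)
    fun x => ?_
  · refine Measurable.ite (measurableSet_le (by fun_prop) measurable_const) measurable_const ?_
    exact (measurable_const.div ((Complex.continuous_conj.measurable.comp
      (by fun_prop)).pow_const 2)).neg
  · unfold discPotentialDeriv
    split_ifs with h
    · rw [norm_div, Complex.norm_real, Real.norm_eq_abs, abs_of_pos (by positivity)]
    · rw [norm_neg, norm_div, norm_pow, Complex.norm_conj, Complex.norm_conj]
      push Not at h
      gcongr

/-- Equality of mixed derivatives of the potential difference, in weak form. On the Fourier side `∂`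
and `∂̄` are multiplications by multiples of `ξ̄` and `ξ`, which commute: both orders give `|ξ|²ψ`
(`hcomm`). One derivative in each order is moved onto the potential difference. -/
lemma integral_fourier_conjTruncKernel_sub (ψ : 𝓢(ℂ, ℂ)) (z : ℂ) {ε R : ℝ} (hε : 0 < ε)
    (hR : 0 < R) :
    (∫ x, 𝓕 (SchwartzMap.smulLeftCLM ℂ (starRingEnd ℂ : ℂ → ℂ) ψ) x * conjTruncKernel z ε x) +
      ∫ x, 𝓕 (SchwartzMap.smulLeftCLM ℂ (fun x : ℂ => x) ψ) x * discAverage z ε x =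
    (∫ x, 𝓕 (SchwartzMap.smulLeftCLM ℂ (starRingEnd ℂ : ℂ → ℂ) ψ) x * conjTruncKernel z R x) +
      ∫ x, 𝓕 (SchwartzMap.smulLeftCLM ℂ (fun x : ℂ => x) ψ) x * discAverage z R x := by
  set a := SchwartzMap.smulLeftCLM ℂ (starRingEnd ℂ : ℂ → ℂ) ψ with ha
  set b := SchwartzMap.smulLeftCLM ℂ (fun x : ℂ => x) ψ with hb
  have hcomm : SchwartzMap.smulLeftCLM ℂ (fun x : ℂ => x) a =
      SchwartzMap.smulLeftCLM ℂ (starRingEnd ℂ : ℂ → ℂ) b := by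
    ext x
    simp only [ha, hb, SchwartzMap.smulLeftCLM_apply_apply hasTemperateGrowth_conj,
      SchwartzMap.smulLeftCLM_apply_apply hasTemperateGrowth_id, smul_eq_mul]
    ring
  have h1 := lineDeriv_one_add_smul_fourier a Complex.I _ hasTemperateGrowth_id fun x => by
    rw [mul_comm, Complex.re_add_im]
  have h2 := lineDeriv_one_add_smul_fourier b (-Complex.I) _ hasTemperateGrowth_conj fun x => by
    apply Complex.ext <;> simp
  rw [hcomm, ← h2] at h1
  have hW : ∀ (g : 𝓢(ℂ, ℂ)), Integrable fun x => g x *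
      (discPotential z ε x - discPotential z R x) := by
    intro g
    obtain ⟨D₁, hD₁⟩ := lipschitzWith_discPotential z hε
    obtain ⟨D₂, hD₂⟩ := lipschitzWith_discPotential z hR
    have hb : ∀ {r : ℝ}, 0 < r → ∀ x, ‖discPotential z r x‖ ≤ 1 / r := by
      intro r hr x
      rw [discPotential, norm_div, Complex.norm_real, Real.norm_eq_abs, abs_of_nonneg (sq_nonneg _)]
      have h1 : r ≤ max r ‖x - z‖ := le_max_left _ _
      have h2 : ‖x - z‖ ≤ max r ‖x - z‖ := le_max_right _ _
      have h3 : 0 < max r ‖x - z‖ := hr.trans_le h1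
      calc _ ≤ max r ‖x - z‖ / max r ‖x - z‖ ^ 2 := by gcongr
        _ = 1 / max r ‖x - z‖ := by field_simp
        _ ≤ _ := by gcongr
    refine integrable_mul_bounded g (C := 1 / ε + 1 / R)
      (k := fun x => discPotential z ε x - discPotential z R x)
      (hD₁.continuous.sub hD₂.continuous).measurable fun x => ?_
    exact (norm_sub_le _ _).trans (add_le_add (hb hε x) (hb hR x))
  have h3 : ∫ x, (∂_{(1 : ℂ)} (𝓕 a) + Complex.I • ∂_{Complex.I} (𝓕 a)) x *
        (discPotential z ε x - discPotential z R x) =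
      ∫ x, (∂_{(1 : ℂ)} (𝓕 b) + (-Complex.I) • ∂_{Complex.I} (𝓕 b)) x *
        (discPotential z ε x - discPotential z R x) := by rw [h1]
  have expand : ∀ (g : 𝓢(ℂ, ℂ)) (c : ℂ), ∫ x, (∂_{(1 : ℂ)} g + c • ∂_{Complex.I} g) x *
        (discPotential z ε x - discPotential z R x) =
      -(∫ x, g x * (discPotentialDeriv z ε 1 x + c * discPotentialDeriv z ε Complex.I x)) +
        ∫ x, g x * (discPotentialDeriv z R 1 x + c * discPotentialDeriv z R Complex.I x) := by
    intro g c
    have e1 : ∀ r : ℝ, 0 < r → ∫ x, g x * (discPotentialDeriv z r 1 x +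
        c * discPotentialDeriv z r Complex.I x) = (∫ x, g x * discPotentialDeriv z r 1 x) +
          c * ∫ x, g x * discPotentialDeriv z r Complex.I x := by
      intro r hr
      rw [← integral_const_mul, ← integral_add (integrable_mul_discPotentialDeriv g 1 z hr)
        ((integrable_mul_discPotentialDeriv g Complex.I z hr).const_mul c)]
      congr 1 with x
      ring
    have e2 : ∀ v : ℂ, ∫ x, g x * (discPotentialDeriv z ε v x - discPotentialDeriv z R v x) =
        (∫ x, g x * discPotentialDeriv z ε v x) - ∫ x, g x * discPotentialDeriv z R v x := by
      intro v
      rw [← integral_sub (integrable_mul_discPotentialDeriv g v z hε)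
        (integrable_mul_discPotentialDeriv g v z hR)]
      congr 1 with x
      ring
    have e3 : ∫ x, (∂_{(1 : ℂ)} g + c • ∂_{Complex.I} g) x *
        (discPotential z ε x - discPotential z R x) =
        (∫ x, (∂_{(1 : ℂ)} g) x * (discPotential z ε x - discPotential z R x)) +
        c * ∫ x, (∂_{Complex.I} g) x * (discPotential z ε x - discPotential z R x) := by
      rw [← integral_const_mul, ← integral_add (hW _) ((hW _).const_mul c)]
      congr 1 with x
      rw [_root_.add_apply, _root_.smul_apply, smul_eq_mul]
      ring
    rw [e3, integral_lineDeriv_mul_discPotential g 1 z hε hR,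
      integral_lineDeriv_mul_discPotential g Complex.I z hε hR, e1 ε hε, e1 R hR, e2, e2]
    ring
  rw [expand, expand] at h3
  simp only [neg_mul, ← sub_eq_add_neg, discPotentialDeriv_add, discPotentialDeriv_sub] at h3
  have e4 : ∀ (g : 𝓢(ℂ, ℂ)) (k : ℂ → ℂ), ∫ x, g x * (2 * Real.pi * k x) =
      2 * Real.pi * ∫ x, g x * k x := by
    intro g k
    rw [← integral_const_mul]
    congr 1 with x
    ring
  simp only [mul_neg, integral_neg, e4] at h3
  have hpi : (2 * Real.pi : ℂ) ≠ 0 := by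
    simp [Real.pi_ne_zero]
  refine mul_left_cancel₀ hpi ?_
  linear_combination h3

lemma tendsto_integral_mul_atTop (g : 𝓢(ℂ, ℂ)) {k : ℝ → ℂ → ℂ}
    (hk : ∀ R, 0 < R → ∀ x, ‖k R x‖ ≤ 1 / (Real.pi * R ^ 2)) :
    Tendsto (fun R => ∫ x, g x * k R x) atTop (𝓝 0) := by
  have h0 : Tendsto (fun R : ℝ => 1 / (Real.pi * R ^ 2) * ∫ x, ‖g x‖) atTop (𝓝 0) := by
    have : Tendsto (fun R : ℝ => 1 / (Real.pi * R ^ 2)) atTop (𝓝 0) := by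
      simp only [one_div]
      exact ((tendsto_pow_atTop two_ne_zero).const_mul_atTop Real.pi_pos).inv_tendsto_atTop
    simpa using this.mul_const (∫ x, ‖g x‖)
  refine squeeze_zero_norm' ?_ h0
  filter_upwards [eventually_gt_atTop 0] with R hR
  rw [← integral_const_mul]
  refine norm_integral_le_of_norm_le (g.integrable.norm.const_mul _)
    (Eventually.of_forall fun x => ?_)
  rw [norm_mul, mul_comm]
  gcongr
  exact hk R hR x

/-- The distributional identity `∂ k = -∂̄ χ` between the conjugate truncated kernel `k` and the
normalized indicator function `χ` of a disc, on the Fourier side. -/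
lemma integral_fourier_conjTruncKernel (ψ : 𝓢(ℂ, ℂ)) (z : ℂ) {ε : ℝ} (hε : 0 < ε) :
    (∫ x, 𝓕 (SchwartzMap.smulLeftCLM ℂ (starRingEnd ℂ : ℂ → ℂ) ψ) x * conjTruncKernel z ε x) +
      ∫ x, 𝓕 (SchwartzMap.smulLeftCLM ℂ (fun x : ℂ => x) ψ) x * discAverage z ε x = 0 := by
  have h := (tendsto_integral_mul_atTop (𝓕 (SchwartzMap.smulLeftCLM ℂ (starRingEnd ℂ : ℂ → ℂ) ψ))
    (k := conjTruncKernel z) fun R hR => norm_conjTruncKernel_le z hR).add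
    (tendsto_integral_mul_atTop (𝓕 (SchwartzMap.smulLeftCLM ℂ (fun x : ℂ => x) ψ))
      (k := discAverage z) fun R hR => norm_discAverage_le z hR)
  rw [add_zero] at h
  -- The sum does not depend on the radius, and it tends to zero as the radius grows.
  refine tendsto_nhds_unique (tendsto_const_nhds.congr' ?_) h
  filter_upwards [eventually_gt_atTop 0] with R hR
  exact integral_fourier_conjTruncKernel_sub ψ z hε hR

/-! ### Truncations of the `L²` transform are disc averages. -/

lemma memLp_conjTruncKernel (z : ℂ) {ε : ℝ} (hε : 0 < ε) {q : ℝ} (hq : 1 < q) :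
    MemLp (conjTruncKernel z ε) (ENNReal.ofReal q) volume := by
  have hq0 : 0 < q := by linarith
  have h1 : MemLp (fun x : ℂ => (1 + ‖x‖) ^ (-2 : ℝ)) (ENNReal.ofReal q) volume := by
    rw [← integrable_norm_rpow_iff (Measurable.aestronglyMeasurable (by fun_prop)) (by simpa using hq0) (by simp),
      ENNReal.toReal_ofReal hq0.le]
    have h2 : Integrable (fun x : ℂ => (1 + ‖x‖) ^ (-(2 * q))) volume :=
      integrable_one_add_norm (by rw [Complex.finrank_real_complex]; push_cast; linarith)
    refine h2.congr (Eventually.of_forall fun x => ?_)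
    have : 0 ≤ 1 + ‖x‖ := by positivity
    simp only [Real.norm_eq_abs]
    rw [abs_of_nonneg (by positivity), ← Real.rpow_mul this]
    ring_nf
  refine (memLp_comp_sub_right h1 z).of_le_mul (c := ((1 + ε) / ε) ^ 2 / Real.pi)
    (measurable_conjTruncKernel z ε).aestronglyMeasurable (Eventually.of_forall fun ζ => ?_)
  have hpi := Real.pi_pos
  rw [Real.norm_eq_abs, abs_of_nonneg (by positivity)]
  unfold conjTruncKernel
  split_ifs with h
  · rw [norm_zero]; positivity
  · push Not at h
    have h0 : 0 < ‖ζ - z‖ := hε.trans h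
    rw [norm_div, norm_mul, norm_pow, Complex.norm_conj, norm_one, Complex.norm_real,
      Real.norm_eq_abs, abs_of_pos Real.pi_pos, Real.rpow_neg (by positivity), Real.rpow_two]
    have h3 : 1 / ‖ζ - z‖ ≤ (1 + ε) / ε * (1 + ‖ζ - z‖)⁻¹ := by
      rw [← div_eq_mul_inv, div_div, div_le_div_iff₀ h0 (by positivity)]
      nlinarith
    calc 1 / (Real.pi * ‖ζ - z‖ ^ 2) = (1 / ‖ζ - z‖) ^ 2 / Real.pi := by field_simp
      _ ≤ ((1 + ε) / ε * (1 + ‖ζ - z‖)⁻¹) ^ 2 / Real.pi := by gcongr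
      _ = _ := by rw [mul_pow, inv_pow]; ring

lemma memLp_discAverage (z : ℂ) (ε : ℝ) (q : ℝ≥0∞) : MemLp (discAverage z ε) q volume := by
  have : discAverage z ε = (Metric.closedBall z ε).indicator
      fun _ => ((1 / (Real.pi * ε ^ 2) : ℝ) : ℂ) := by
    ext ζ
    have hm : ζ ∈ Metric.closedBall z ε ↔ ‖ζ - z‖ ≤ ε := by rw [Metric.mem_closedBall, dist_eq_norm]
    rw [discAverage]
    split_ifs with h
    · rw [Set.indicator_of_mem (hm.2 h)]
    · rw [Set.indicator_of_notMem (mt hm.1 h)]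
  rw [this]
  exact memLp_indicator_const q measurableSet_closedBall _
    (Or.inr (measure_closedBall_lt_top (x := z) (r := ε)).ne)

lemma memLp_two_conjTruncKernel (z : ℂ) {ε : ℝ} (hε : 0 < ε) :
    MemLp (conjTruncKernel z ε) 2 volume := by
  simpa using memLp_conjTruncKernel z hε one_lt_two

lemma integral_fourier_mul_eq_fourierL2 (ψ : 𝓢(ℂ, ℂ)) {f : ℂ → ℂ} (hf : MemLp f 2 volume) :
    ∫ x, 𝓕 ψ x * f x = ∫ x, ψ x * fourierL2 (hf.toLp f) x := by
  have h := congrArg (fun T => T ψ) (Lp.fourier_toTemperedDistribution_eq (hf.toLp f))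
  simp only [TemperedDistribution.fourier_apply, Lp.toTemperedDistribution_apply,
    smul_eq_mul] at h
  refine Eq.trans (integral_congr_ae ?_) h
  filter_upwards [hf.coeFn_toLp] with x hx
  rw [hx]

lemma locallyIntegrable_mul_L2 {σ : ℂ → ℂ} (hσ : Continuous σ)
    (f : Lp ℂ 2 (volume : Measure ℂ)) : LocallyIntegrable (fun x => σ x * f x) volume := by
  rw [locallyIntegrable_iff]
  intro K hK
  exact (((Lp.memLp f).locallyIntegrable (by norm_num)).integrableOn_isCompact hK).continuousOn_mul
    hσ.continuousOn hK

/-- Tested against all smooth compactly supported functions, the distributional identity reads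
`ξ̄·k̂ + ξ·χ̂ = 0` almost everywhere. Dividing by `ξ̄` leaves the factor `-ξ/ξ̄`, the conjugate of
the symbol. -/
lemma fourierL2_conjTruncKernel (z : ℂ) {ε : ℝ} (hε : 0 < ε) :
    fourierL2 ((memLp_two_conjTruncKernel z hε).toLp _) =ᵐ[volume]
      fun ξ => starRingEnd ℂ (beurlingSymbol ξ) *
        fourierL2 ((memLp_discAverage z ε 2).toLp _) ξ := by
  set k := fourierL2 ((memLp_two_conjTruncKernel z hε).toLp _) with hk
  set c := fourierL2 ((memLp_discAverage z ε 2).toLp _) with hc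
  have hl1 := locallyIntegrable_mul_L2 Complex.continuous_conj k
  have hl2 := locallyIntegrable_mul_L2 continuous_id c
  have key : ∀ᵐ x : ℂ, starRingEnd ℂ x * k x + x * c x = 0 := by
    refine ae_eq_zero_of_integral_contDiff_smul_eq_zero (hl1.add hl2) fun g hg hgc => ?_
    have hgc' : HasCompactSupport fun x => (g x : ℂ) := hgc.comp_left (g := Complex.ofReal) rfl
    have hg' : ContDiff ℝ ((⊤ : ℕ∞) : WithTop ℕ∞) fun x => (g x : ℂ) := Complex.ofRealCLM.contDiff.comp hg
    have h := integral_fourier_conjTruncKernel (hgc'.toSchwartzMap hg') z hε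
    rw [integral_fourier_mul_eq_fourierL2 _ (memLp_two_conjTruncKernel z hε),
      integral_fourier_mul_eq_fourierL2 _ (memLp_discAverage z ε 2), ← hk, ← hc] at h
    simp only [SchwartzMap.smulLeftCLM_apply_apply hasTemperateGrowth_conj,
      SchwartzMap.smulLeftCLM_apply_apply hasTemperateGrowth_id, smul_eq_mul] at h
    have happ : ∀ x, hgc'.toSchwartzMap hg' x = (g x : ℂ) := fun x => rfl
    have i1 := hl1.integrable_smul_left_of_hasCompactSupport hg.continuous hgc
    have i2 := hl2.integrable_smul_left_of_hasCompactSupport hg.continuous hgc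
    have e : ∀ x, g x • (starRingEnd ℂ x * k x + id x * c x) =
        g x • (starRingEnd ℂ x * k x) + g x • (id x * c x) := fun x => smul_add _ _ _
    calc _ = ∫ x, (g x • (starRingEnd ℂ x * k x) + g x • (id x * c x)) := integral_congr_ae
          (Eventually.of_forall e)
      _ = _ := integral_add i1 i2
      _ = _ := by
        rw [← h]
        congr 1
        all_goals
          congr 1 with x
          simp only [happ, Complex.real_smul, id]
          ring
  have hne : ∀ᵐ x : ℂ, x ≠ 0 := by
    rw [ae_iff]; simp
  filter_upwards [key, hne] with x hx hx0
  have hx1 : starRingEnd ℂ x ≠ 0 := (map_ne_zero _).2 hx0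
  rw [beurlingSymbol, map_neg, map_div₀, Complex.conj_conj]
  field_simp
  linear_combination hx

lemma memLp_top_of_norm_le_one {σ : ℂ → ℂ} (hσ : Measurable σ) (h : ∀ x, ‖σ x‖ ≤ 1) :
    MemLp σ ∞ (volume : Measure ℂ) :=
  memLp_top_of_bound hσ.aestronglyMeasurable 1 (Eventually.of_forall h)

/-- The Fourier multiplier operator on `L²(ℂ)` with a given bounded symbol. -/
noncomputable def multiplierL2 {σ : ℂ → ℂ} (hσ : MemLp σ ∞ (volume : Measure ℂ))
    (f : Lp ℂ 2 (volume : Measure ℂ)) : Lp ℂ 2 (volume : Measure ℂ) :=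
  fourierL2.symm (hσ.toLp σ • fourierL2 f : Lp ℂ 2 (volume : Measure ℂ))

lemma fourierL2_multiplierL2 {σ : ℂ → ℂ} (hσ : MemLp σ ∞ (volume : Measure ℂ))
    (f : Lp ℂ 2 (volume : Measure ℂ)) :
    fourierL2 (multiplierL2 hσ f) =ᵐ[volume] fun ξ => σ ξ * fourierL2 f ξ := by
  rw [multiplierL2, LinearIsometryEquiv.apply_symm_apply]
  filter_upwards [Lp.coeFn_lpSMul (r := 2) (hσ.toLp σ) (fourierL2 f), hσ.coeFn_toLp] with x h1 h2
  rw [h1, Pi.smul_apply', h2, smul_eq_mul]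

lemma memLp_beurlingSymbol : MemLp beurlingSymbol ∞ (volume : Measure ℂ) :=
  memLp_top_of_norm_le_one measurable_beurlingSymbol norm_beurlingSymbol_le

/-- The Ahlfors–Beurling transform on `L²(ℂ)`. -/
noncomputable def beurlingL2 (f : Lp ℂ 2 (volume : Measure ℂ)) : Lp ℂ 2 (volume : Measure ℂ) :=
  multiplierL2 memLp_beurlingSymbol f

lemma ahlforsBeurlingTrunc_eq_integral (f : ℂ → ℂ) (ε : ℝ) (z : ℂ) :
    ahlforsBeurlingTrunc f ε z = ∫ ζ, starRingEnd ℂ (conjTruncKernel z ε ζ) * f ζ := by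
  rw [ahlforsBeurlingTrunc, ← integral_const_mul, ← integral_indicator
    (measurableSet_lt measurable_const (by fun_prop))]
  congr 1 with ζ
  rw [Set.indicator_apply, conjTruncKernel]
  by_cases h : ‖ζ - z‖ ≤ ε
  · rw [if_pos h, if_neg (by simpa using h)]; simp
  · rw [if_neg h, if_pos (by simpa using h)]
    simp
    ring

lemma integral_discAverage_mul (f : ℂ → ℂ) {ε : ℝ} (hε : 0 < ε) (z : ℂ) :
    ∫ ζ, discAverage z ε ζ * f ζ = ⨍ ζ in Metric.closedBall z ε, f ζ := by
  rw [setAverage_eq, Measure.real, Complex.volume_closedBall]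
  have h1 : ∀ ζ, discAverage z ε ζ * f ζ = (Metric.closedBall z ε).indicator
      (fun ζ => ((1 / (Real.pi * ε ^ 2) : ℝ) : ℂ) * f ζ) ζ := by
    intro ζ
    have hm : ζ ∈ Metric.closedBall z ε ↔ ‖ζ - z‖ ≤ ε := by rw [Metric.mem_closedBall, dist_eq_norm]
    rw [discAverage]
    split_ifs with h
    · rw [Set.indicator_of_mem (hm.2 h)]
    · rw [Set.indicator_of_notMem (mt hm.1 h), zero_mul]
  simp_rw [h1]
  rw [integral_indicator measurableSet_closedBall, integral_const_mul, Complex.real_smul]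
  congr 2
  rw [ENNReal.toReal_mul, ENNReal.toReal_pow, ENNReal.toReal_ofReal hε.le]
  simp [mul_comm]

/-- The truncated transforms of `f ∈ L²` are the averages over discs of its transform. -/
lemma ahlforsBeurlingTrunc_eq_average {f : ℂ → ℂ} (hf : MemLp f 2 volume) {ε : ℝ} (hε : 0 < ε)
    (z : ℂ) :
    ahlforsBeurlingTrunc f ε z = ⨍ ζ in Metric.closedBall z ε, beurlingL2 (hf.toLp f) ζ := by
  have h1 : inner ℂ ((memLp_two_conjTruncKernel z hε).toLp _) (hf.toLp f) =
      inner ℂ ((memLp_discAverage z ε 2).toLp _) (beurlingL2 (hf.toLp f)) := by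
    -- By Plancherel the symbol moves from the disc indicator to `f`; the conjugation in the inner
    -- product is why the kernel was taken conjugated.
    rw [← fourierL2.inner_map_map, ← fourierL2.inner_map_map ((memLp_discAverage z ε 2).toLp _),
      L2.inner_def, L2.inner_def]
    refine integral_congr_ae ?_
    filter_upwards [fourierL2_conjTruncKernel z hε,
      fourierL2_multiplierL2 memLp_beurlingSymbol (hf.toLp f)] with ξ g1 g2
    rw [g1, beurlingL2, g2]
    simp only [RCLike.inner_apply, map_mul, Complex.conj_conj]
    ring
  rw [ahlforsBeurlingTrunc_eq_integral, ← integral_discAverage_mul _ hε]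
  rw [L2.inner_def, L2.inner_def] at h1
  refine Eq.trans (integral_congr_ae ?_) (h1.trans (integral_congr_ae ?_))
  · filter_upwards [(memLp_two_conjTruncKernel z hε).coeFn_toLp, hf.coeFn_toLp] with ζ g1 g2
    rw [g1, g2, RCLike.inner_apply, mul_comm]
  · filter_upwards [(memLp_discAverage z ε 2).coeFn_toLp] with ζ g1
    rw [g1, RCLike.inner_apply, mul_comm, discAverage]
    split_ifs
    · rw [Complex.conj_ofReal]
    · simp

/-! ### From directional estimates to `L^p`. -/

lemma re_add_I_mul_re_mul_beurlingSymbol (u : ℂ) (ξ : ℂ) :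
    (((u * beurlingSymbol ξ).re : ℝ) : ℂ) + Complex.I * (((-Complex.I * u * beurlingSymbol ξ).re : ℝ) : ℂ)
      = u * beurlingSymbol ξ := by
  conv_rhs => rw [← Complex.re_add_im (u * beurlingSymbol ξ)]
  have : (-Complex.I * u * beurlingSymbol ξ).re = (u * beurlingSymbol ξ).im := by
    rw [mul_assoc, Complex.mul_re]; simp
  rw [this]; ring

lemma memLp_re_mul_beurlingSymbol {u : ℂ} (hu : ‖u‖ = 1) :
    MemLp (fun ξ => (((u * beurlingSymbol ξ).re : ℝ) : ℂ)) ∞ (volume : Measure ℂ) := by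
  refine memLp_top_of_norm_le_one (Complex.measurable_ofReal.comp
    (Complex.measurable_re.comp (measurable_beurlingSymbol.const_mul u))) fun ξ => ?_
  rw [Complex.norm_real]
  refine (Complex.abs_re_le_norm _).trans ?_
  rw [norm_mul, hu, one_mul]
  exact norm_beurlingSymbol_le ξ

/-- Here `u·T = A + iB`, where `A` and `B` have the real symbols `Re(um)` and `Im(um) = Re(-ium)`.
Both take `f` to a real-valued function, so `Re(u·Tf)` is `Af`, controlled by `directional_bound`.
-/
lemma eLpNorm_re_mul_beurlingL2_le {p : ℝ} (hp : 2 ≤ p) {f : ℂ → ℝ}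
    (hf : MemLp f (ENNReal.ofReal p) volume) (hf2 : MemLp (fun x => (f x : ℂ)) 2 volume)
    {u : ℂ} (hu : ‖u‖ = 1) :
    eLpNorm (fun x => (u * beurlingL2 (hf2.toLp _) x).re) (ENNReal.ofReal p) volume ≤
      ENNReal.ofReal (p - 1) * eLpNorm f (ENNReal.ofReal p) volume := by
  have hu' : ‖-Complex.I * u‖ = 1 := by simp [hu]
  set f₂ := hf2.toLp _ with hf₂
  set A := multiplierL2 (memLp_re_mul_beurlingSymbol hu) f₂ with hA
  set B := multiplierL2 (memLp_re_mul_beurlingSymbol hu') f₂ with hB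
  have hFA := fourierL2_multiplierL2 (memLp_re_mul_beurlingSymbol hu) f₂
  have hFB := fourierL2_multiplierL2 (memLp_re_mul_beurlingSymbol hu') f₂
  obtain ⟨hAim, hAle⟩ := directional_bound hp hf hf2 hu hFA
  obtain ⟨hBim, -⟩ := directional_bound hp hf hf2 hu' hFB
  have heq : u • beurlingL2 f₂ = A + Complex.I • B := by
    apply fourierL2.injective
    rw [map_add, map_smul, map_smul]
    apply Lp.ext
    filter_upwards [Lp.coeFn_smul u (fourierL2 (beurlingL2 f₂)),
      Lp.coeFn_add (fourierL2 A) (Complex.I • fourierL2 B),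
      Lp.coeFn_smul Complex.I (fourierL2 B), hFA, hFB,
      fourierL2_multiplierL2 memLp_beurlingSymbol f₂] with ξ h1 h2 h3 h4 h5 h6
    rw [h1, h2, Pi.smul_apply, Pi.add_apply, h3, Pi.smul_apply, h4, h5, beurlingL2, h6,
      smul_eq_mul, smul_eq_mul]
    linear_combination -fourierL2 f₂ ξ * re_add_I_mul_re_mul_beurlingSymbol u ξ
  refine le_trans (le_of_eq (eLpNorm_congr_ae ?_)) hAle
  filter_upwards [Lp.coeFn_smul u (beurlingL2 f₂), Lp.coeFn_add A (Complex.I • B),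
    Lp.coeFn_smul Complex.I B, hBim] with x h1 h2 h3 h4
  rw [heq, h2, Pi.add_apply, h3, Pi.smul_apply, Pi.smul_apply, smul_eq_mul, smul_eq_mul] at h1
  rw [← h1]
  change (B x).im = 0 at h4
  rw [Complex.add_re, Complex.I_mul_re, h4, neg_zero, add_zero]

lemma beurlingL2_sub (f g : Lp ℂ 2 (volume : Measure ℂ)) :
    beurlingL2 (f - g) = beurlingL2 f - beurlingL2 g := by
  apply fourierL2.injective
  rw [map_sub]
  apply Lp.ext
  filter_upwards [fourierL2_multiplierL2 memLp_beurlingSymbol f,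
    fourierL2_multiplierL2 memLp_beurlingSymbol g,
    fourierL2_multiplierL2 memLp_beurlingSymbol (f - g),
    Lp.coeFn_sub (fourierL2 f) (fourierL2 g),
    Lp.coeFn_sub (fourierL2 (beurlingL2 f)) (fourierL2 (beurlingL2 g))] with x h1 h2 h3 h4 h5
  rw [h5, Pi.sub_apply, beurlingL2, beurlingL2, beurlingL2, h1, h2, h3, map_sub, h4, Pi.sub_apply,
    mul_sub]

lemma eLpNorm_re_mul_beurlingL2_sub_le {p : ℝ} (hp : 2 ≤ p) {f g : ℂ → ℝ}
    (hf : MemLp f (ENNReal.ofReal p) volume) (hf2 : MemLp (fun x => (f x : ℂ)) 2 volume)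
    (hg : MemLp g (ENNReal.ofReal p) volume) (hg2 : MemLp (fun x => (g x : ℂ)) 2 volume)
    {u : ℂ} (hu : ‖u‖ = 1) :
    eLpNorm (fun x => (u * (beurlingL2 (hf2.toLp _) x - beurlingL2 (hg2.toLp _) x)).re)
        (ENNReal.ofReal p) volume ≤
      ENNReal.ofReal (p - 1) * eLpNorm (f - g) (ENNReal.ofReal p) volume := by
  have h2 : MemLp (fun x => ((f - g) x : ℂ)) 2 volume := by
    have h := hf2.sub hg2
    simp only [Pi.sub_apply, Complex.ofReal_sub]
    exact h
  have heq : h2.toLp _ = hf2.toLp _ - hg2.toLp _ := by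
    rw [← MemLp.toLp_sub]
    exact MemLp.toLp_congr _ _ (Eventually.of_forall fun x => by simp)
  refine le_trans (le_of_eq (eLpNorm_congr_ae ?_))
    (eLpNorm_re_mul_beurlingL2_le hp (hf.sub hg) h2 hu)
  rw [heq, beurlingL2_sub]
  filter_upwards [Lp.coeFn_sub (beurlingL2 (hf2.toLp _)) (beurlingL2 (hg2.toLp _))] with x hx
  rw [hx, Pi.sub_apply]

lemma eLpNorm_le_re_add_im {P : ℝ≥0∞} (hP : 1 ≤ P) {F : ℂ → ℂ} (hF : AEStronglyMeasurable F volume) :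
    eLpNorm F P volume ≤ eLpNorm (fun x => (1 * F x).re) P volume +
      eLpNorm (fun x => (-Complex.I * F x).re) P volume := by
  have h1 : AEStronglyMeasurable (fun x => (1 * F x).re) volume :=
    Complex.continuous_re.comp_aestronglyMeasurable (hF.const_mul 1)
  have h2 : AEStronglyMeasurable (fun x => (-Complex.I * F x).re) volume :=
    Complex.continuous_re.comp_aestronglyMeasurable (hF.const_mul _)
  rw [← eLpNorm_norm (fun x => (1 * F x).re), ← eLpNorm_norm (fun x => (-Complex.I * F x).re)]
  refine le_trans (eLpNorm_mono_real fun x => ?_) (eLpNorm_add_le h1.norm h2.norm hP)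
  simpa using Complex.norm_le_abs_re_add_abs_im (F x)

/-- The canonical approximation of a function by compactly supported ones. -/
noncomputable def ballCutoff (f : ℂ → ℝ) (n : ℕ) : ℂ → ℝ :=
  (Metric.closedBall (0 : ℂ) n).indicator f

lemma memLp_ballCutoff {P : ℝ≥0∞} {f : ℂ → ℝ} (hf : MemLp f P volume) (n : ℕ) :
    MemLp (ballCutoff f n) P volume := hf.indicator measurableSet_closedBall

lemma memLp_two_ballCutoff {P : ℝ≥0∞} (hP : 2 ≤ P) {f : ℂ → ℝ} (hf : MemLp f P volume) (n : ℕ) :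
    MemLp (fun x => (ballCutoff f n x : ℂ)) 2 volume := by
  refine MemLp.ofReal ?_
  refine (memLp_indicator_iff_restrict measurableSet_closedBall).2 ?_
  have : IsFiniteMeasure ((volume : Measure ℂ).restrict (Metric.closedBall (0 : ℂ) n)) :=
    isFiniteMeasure_restrict.2 measure_closedBall_lt_top.ne
  exact (hf.restrict _).mono_exponent hP

lemma tendsto_toLp_ballCutoff {P : ℝ≥0∞} [Fact (1 ≤ P)] (hP : P ≠ ∞) {f : ℂ → ℝ}
    (hf : MemLp f P volume) :
    Tendsto (fun n => (memLp_ballCutoff hf n).toLp _) atTop (𝓝 (hf.toLp f)) := by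
  refine tendsto_Lp_of_dominated hP hf (fun n => ?_) ?_
  · filter_upwards [(memLp_ballCutoff hf n).coeFn_toLp, hf.coeFn_toLp] with x h1 h2
    rw [h1, h2, ballCutoff]
    by_cases h : x ∈ Metric.closedBall (0 : ℂ) n <;> simp [h]
  · have : ∀ᵐ x, ∀ n, (memLp_ballCutoff hf n).toLp _ x = ballCutoff f n x :=
      ae_all_iff.2 fun n => (memLp_ballCutoff hf n).coeFn_toLp
    filter_upwards [this, hf.coeFn_toLp] with x h1 h2
    simp only [h1, h2]
    refine tendsto_const_nhds.congr' ?_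
    obtain ⟨N, hN⟩ := exists_nat_ge ‖x‖
    filter_upwards [eventually_ge_atTop N] with n hn
    rw [ballCutoff, Set.indicator_of_mem]
    rw [mem_closedBall_zero_iff]
    exact hN.trans (by exact_mod_cast hn)

lemma tendsto_integral_mul_of_eLpNorm {P Q : ℝ≥0∞} [ENNReal.HolderConjugate Q P] {k : ℂ → ℂ}
    (hk : MemLp k Q volume) {F : ℕ → ℂ → ℂ} {G : ℂ → ℂ} (hF : ∀ n, MemLp (F n) P volume)
    (hG : MemLp G P volume)
    (hlim : Tendsto (fun n => eLpNorm (F n - G) P volume) atTop (𝓝 0)) :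
    Tendsto (fun n => ∫ x, k x * F n x) atTop (𝓝 (∫ x, k x * G x)) := by
  refine tendsto_integral_of_L1' _ (hk.1.mul hG.1)
    (Eventually.of_forall fun n => hk.integrable_mul (hF n)) ?_
  have hfin : eLpNorm k Q volume ≠ ∞ := hk.eLpNorm_ne_top
  have h0 : Tendsto (fun n => eLpNorm k Q volume * eLpNorm (F n - G) P volume) atTop (𝓝 0) := by
    simpa using ENNReal.Tendsto.const_mul hlim (Or.inr hfin)
  refine tendsto_of_tendsto_of_tendsto_of_le_of_le tendsto_const_nhds h0 (fun n => zero_le)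
    fun n => ?_
  refine le_trans (le_of_eq ?_) (eLpNorm_smul_le_mul_eLpNorm (r := 1) ((hF n).sub hG).1 hk.1)
  congr 1 with x
  simp [mul_sub]

lemma one_lt_div_sub_one {p : ℝ} (hp : 2 ≤ p) : 1 < p / (p - 1) := by
  rw [lt_div_iff₀ (by linarith)]; linarith

lemma holderConjugate_div_sub_one {p : ℝ} (hp : 2 ≤ p) :
    ENNReal.HolderConjugate (ENNReal.ofReal (p / (p - 1))) (ENNReal.ofReal p) :=
  ((Real.holderConjugate_iff_eq_conjExponent (by linarith)).2 rfl).symm.ennrealOfReal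

lemma memLp_conj_conjTruncKernel (z : ℂ) {ε : ℝ} (hε : 0 < ε) {q : ℝ} (hq : 1 < q) :
    MemLp (fun ζ => starRingEnd ℂ (conjTruncKernel z ε ζ)) (ENNReal.ofReal q) volume :=
  (memLp_conjTruncKernel z hε hq).of_le
    (Complex.continuous_conj.comp_aestronglyMeasurable (memLp_conjTruncKernel z hε hq).1)
    (Eventually.of_forall fun ζ => by rw [Complex.norm_conj])

lemma integrableOn_div_sq {p : ℝ} (hp : 2 ≤ p) {f : ℂ → ℂ}
    (hf : MemLp f (ENNReal.ofReal p) volume) (z : ℂ) {ε : ℝ} (hε : 0 < ε) :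
    IntegrableOn (fun ζ : ℂ => f ζ / (ζ - z) ^ 2) {ζ : ℂ | ε < ‖ζ - z‖} := by
  have := holderConjugate_div_sub_one hp
  have h := ((memLp_conj_conjTruncKernel z hε (one_lt_div_sub_one hp)).integrable_mul hf).const_mul
    (Real.pi : ℂ)
  refine (h.integrableOn (s := {ζ : ℂ | ε < ‖ζ - z‖})).congr_fun (fun ζ hζ => ?_)
    (measurableSet_lt measurable_const (by fun_prop))
  have hpi : (Real.pi : ℂ) ≠ 0 := by exact_mod_cast Real.pi_ne_zero
  have h0 : ζ - z ≠ 0 := norm_pos_iff.1 (hε.trans hζ)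
  have hn : ¬ ‖ζ - z‖ ≤ ε := not_le.2 hζ
  simp only [Pi.mul_apply, conjTruncKernel, if_neg hn, map_div₀, map_mul, map_pow, map_one,
    Complex.conj_conj, Complex.conj_ofReal]
  field_simp

lemma cauchySeq_of_edist_le {X Y : Type*} [PseudoEMetricSpace X] [PseudoEMetricSpace Y]
    {a : ℕ → X} {b : ℕ → Y} {C : ℝ≥0} (ha : CauchySeq a)
    (h : ∀ m n, edist (b m) (b n) ≤ C * edist (a m) (a n)) : CauchySeq b := by
  rw [EMetric.cauchySeq_iff] at ha ⊢
  intro ε hε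
  obtain ⟨N, hN⟩ := ha (ε / (C + 1 : ℝ≥0)) (ENNReal.div_pos hε.ne' ENNReal.coe_ne_top)
  refine ⟨N, fun m hm n hn => ?_⟩
  calc edist (b m) (b n) ≤ (C + 1 : ℝ≥0) * edist (a m) (a n) := by
        refine (h m n).trans ?_
        gcongr
        exact_mod_cast (le_add_of_nonneg_right zero_le_one : C ≤ C + 1)
    _ < (C + 1 : ℝ≥0) * (ε / (C + 1 : ℝ≥0)) := by
        refine ENNReal.mul_lt_mul_right (by positivity) ENNReal.coe_ne_top (hN m hm n hn)
    _ ≤ ε := ENNReal.mul_div_le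

lemma ofReal_two_mul_sub_one {p : ℝ} (a : ℝ≥0∞) :
    ENNReal.ofReal (p - 1) * a + ENNReal.ofReal (p - 1) * a = (2 * (p - 1).toNNReal : ℝ≥0) * a := by
  rw [← two_mul, ENNReal.coe_mul, ENNReal.ofReal]
  push_cast
  ring

/-- The cutoffs lie in both `L²` and `L^p`. The crude constant `2(p-1)` for the full complex
transform is enough to make their transforms a Cauchy sequence. -/
lemma exists_Lp_limit {p : ℝ} (hp : 2 ≤ p) {f : ℂ → ℝ} (hf : MemLp f (ENNReal.ofReal p) volume) :
    ∃ F : ℂ → ℂ, MemLp F (ENNReal.ofReal p) volume ∧ ∃ G : ℕ → ℂ → ℂ,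
      (∀ n, MemLp (G n) (ENNReal.ofReal p) volume) ∧
      (∀ n, ∃ hn : MemLp (fun x => (ballCutoff f n x : ℂ)) 2 volume, G n = beurlingL2 (hn.toLp _)) ∧
      Tendsto (fun n => eLpNorm (G n - F) (ENNReal.ofReal p) volume) atTop (𝓝 0) := by
  have hP : (2 : ℝ≥0∞) ≤ ENNReal.ofReal p := by
    rw [← ENNReal.ofReal_ofNat]; exact ENNReal.ofReal_le_ofReal hp
  have hP1 : (1 : ℝ≥0∞) ≤ ENNReal.ofReal p := one_le_two.trans hP
  have : Fact (1 ≤ ENNReal.ofReal p) := ⟨hP1⟩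
  have hu1 : ‖(1 : ℂ)‖ = 1 := norm_one
  have hu2 : ‖-Complex.I‖ = 1 := by simp
  have h2 := memLp_two_ballCutoff hP hf
  have hc := memLp_ballCutoff hf
  have hG : ∀ n, MemLp (beurlingL2 ((h2 n).toLp _)) (ENNReal.ofReal p) volume := fun n => by
    refine ⟨Lp.aestronglyMeasurable _, (eLpNorm_le_re_add_im hP1 (Lp.aestronglyMeasurable _)).trans_lt ?_⟩
    refine ENNReal.add_lt_top.2 ⟨?_, ?_⟩
    · exact (eLpNorm_re_mul_beurlingL2_le hp (hc n) (h2 n) hu1).trans_lt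
        (ENNReal.mul_lt_top ENNReal.ofReal_lt_top (hc n).2)
    · exact (eLpNorm_re_mul_beurlingL2_le hp (hc n) (h2 n) hu2).trans_lt
        (ENNReal.mul_lt_top ENNReal.ofReal_lt_top (hc n).2)
  have hcau : CauchySeq fun n => (hG n).toLp _ := by
    refine cauchySeq_of_edist_le (C := 2 * (p - 1).toNNReal)
      (tendsto_toLp_ballCutoff ENNReal.ofReal_ne_top hf).cauchySeq fun m n => ?_
    rw [Lp.edist_toLp_toLp, Lp.edist_toLp_toLp, ← ofReal_two_mul_sub_one]
    refine (eLpNorm_le_re_add_im hP1 ((hG m).sub (hG n)).1).trans (add_le_add ?_ ?_)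
    · exact eLpNorm_re_mul_beurlingL2_sub_le hp (hc m) (h2 m) (hc n) (h2 n) hu1
    · exact eLpNorm_re_mul_beurlingL2_sub_le hp (hc m) (h2 m) (hc n) (h2 n) hu2
  obtain ⟨F, hF⟩ := cauchySeq_tendsto_of_complete hcau
  refine ⟨F, Lp.memLp F, fun n => beurlingL2 ((h2 n).toLp _), hG, fun n => ⟨h2 n, rfl⟩, ?_⟩
  rw [tendsto_iff_edist_tendsto_0] at hF
  refine hF.congr fun n => ?_
  rw [Lp.edist_def]
  refine eLpNorm_congr_ae ?_
  filter_upwards [(hG n).coeFn_toLp] with x hx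
  simp [hx]

/-- For fixed `z` and `ε`, the truncation and the disc average are pairings with functions in
`L^{p'}`, so their equality passes from the cutoffs to `f`. The sharp directional bounds also pass
to the limit. -/
lemma exists_beurling_transform {p : ℝ} (hp : 2 ≤ p) {f : ℂ → ℝ}
    (hf : MemLp f (ENNReal.ofReal p) volume) :
    ∃ F : ℂ → ℂ, MemLp F (ENNReal.ofReal p) volume ∧
      (∀ u : ℂ, ‖u‖ = 1 → eLpNorm (fun x => (u * F x).re) (ENNReal.ofReal p) volume ≤
        ENNReal.ofReal (p - 1) * eLpNorm f (ENNReal.ofReal p) volume) ∧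
      ∀ᵐ z : ℂ, AhlforsBeurlingExistsAt (fun ζ => (f ζ : ℂ)) z ∧
        ahlforsBeurling (fun ζ => (f ζ : ℂ)) z = F z := by
  have hP : (2 : ℝ≥0∞) ≤ ENNReal.ofReal p := by
    rw [← ENNReal.ofReal_ofNat]; exact ENNReal.ofReal_le_ofReal hp
  have hP1 : (1 : ℝ≥0∞) ≤ ENNReal.ofReal p := one_le_two.trans hP
  have : Fact (1 ≤ ENNReal.ofReal p) := ⟨hP1⟩
  have hconj := holderConjugate_div_sub_one hp
  have hq := one_lt_div_sub_one hp
  obtain ⟨F, hF, G, hG, hGT, hlim⟩ := exists_Lp_limit hp hf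
  have hfc : MemLp (fun ζ => (f ζ : ℂ)) (ENNReal.ofReal p) volume := hf.ofReal
  have hflim : Tendsto (fun n => eLpNorm ((fun x => (ballCutoff f n x : ℂ)) - fun x => (f x : ℂ))
      (ENNReal.ofReal p) volume) atTop (𝓝 0) := by
    have h := tendsto_toLp_ballCutoff ENNReal.ofReal_ne_top hf
    rw [tendsto_iff_edist_tendsto_0] at h
    refine h.congr fun n => ?_
    rw [Lp.edist_toLp_toLp]
    refine eLpNorm_congr_norm_ae (Eventually.of_forall fun x => ?_)
    simp only [Pi.sub_apply]
    rw [← Complex.ofReal_sub, Complex.norm_real]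
  have havg : ∀ z : ℂ, ∀ ε : ℝ, 0 < ε → ahlforsBeurlingTrunc (fun ζ => (f ζ : ℂ)) ε z =
      ⨍ ζ in Metric.closedBall z ε, F ζ := by
    intro z ε hε
    have l1 := tendsto_integral_mul_of_eLpNorm (memLp_conj_conjTruncKernel z hε hq)
      (fun n => (memLp_ballCutoff hf n).ofReal (K := ℂ)) hfc hflim
    have l2 := tendsto_integral_mul_of_eLpNorm (memLp_discAverage z ε (ENNReal.ofReal (p / (p - 1)))) hG hF hlim
    rw [integral_discAverage_mul _ hε] at l2
    rw [ahlforsBeurlingTrunc_eq_integral]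
    refine tendsto_nhds_unique l1 (l2.congr fun n => ?_)
    obtain ⟨hn, hGn⟩ := hGT n
    rw [integral_discAverage_mul _ hε, hGn, ← ahlforsBeurlingTrunc_eq_average hn hε,
      ahlforsBeurlingTrunc_eq_integral]
    rfl
  refine ⟨F, hF, fun u hu => ?_, ?_⟩
  · have hb : ∀ n, eLpNorm (fun x => (u * F x).re) (ENNReal.ofReal p) volume ≤
        ENNReal.ofReal (p - 1) * eLpNorm f (ENNReal.ofReal p) volume +
          eLpNorm (G n - F) (ENNReal.ofReal p) volume := by
      intro n
      obtain ⟨hn, hGn⟩ := hGT n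
      have m1 : AEStronglyMeasurable (fun x => (u * G n x).re) volume :=
        Complex.continuous_re.comp_aestronglyMeasurable ((hG n).1.const_mul u)
      have m2 : AEStronglyMeasurable (fun x => (u * (G n x - F x)).re) volume :=
        Complex.continuous_re.comp_aestronglyMeasurable (((hG n).sub hF).1.const_mul u)
      have e : (fun x => (u * F x).re) =
          (fun x => (u * G n x).re) - fun x => (u * (G n x - F x)).re := by
        ext x; simp; ring
      rw [e]
      refine (eLpNorm_sub_le m1 m2 hP1).trans (add_le_add ?_ ?_)
      · rw [hGn]
        refine (eLpNorm_re_mul_beurlingL2_le hp (memLp_ballCutoff hf n) hn hu).trans ?_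
        gcongr
        exact eLpNorm_indicator_le _
      · refine eLpNorm_mono fun x => ?_
        rw [Real.norm_eq_abs]
        refine (Complex.abs_re_le_norm _).trans ?_
        rw [norm_mul, hu, one_mul, Pi.sub_apply]
    have hl := hlim.const_add (ENNReal.ofReal (p - 1) * eLpNorm f (ENNReal.ofReal p) volume)
    rw [add_zero] at hl
    exact ge_of_tendsto' hl hb
  -- Lebesgue differentiation of `F`, applied to the identity between truncations and averages,
  -- produces the principal value.
  · filter_upwards [IsUnifLocDoublingMeasure.ae_tendsto_average volume
      (hF.locallyIntegrable hP1) 1] with z hz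
    have hz' := hz (l := 𝓝[>] (0 : ℝ)) (fun _ => z) id tendsto_id (by
      filter_upwards [self_mem_nhdsWithin] with ε hε
      have : (0 : ℝ) < ε := hε
      simpa using this.le)
    have ht : Tendsto (fun ε => ahlforsBeurlingTrunc (fun ζ => (f ζ : ℂ)) ε z) (𝓝[>] (0 : ℝ))
        (𝓝 (F z)) := by
      refine hz'.congr' ?_
      filter_upwards [self_mem_nhdsWithin] with ε hε
      exact (havg z ε hε).symm
    exact ⟨⟨fun ε hε => integrableOn_div_sq hp hfc z hε, F z, ht⟩, ht.limUnder_eq⟩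

/-! ### The constant `√2` and the bilinear estimate. -/

/-- Since `p/2 ≥ 1`, the triangle inequality in `L^{p/2}` applied to `|F|² = (Re F)² + (Im F)²`
gives `‖F‖_p² ≤ 2B²`. -/
lemma eLpNorm_le_sqrt_two_mul {p : ℝ} (hp : 2 ≤ p) {F : ℂ → ℂ}
    (hF : AEStronglyMeasurable F volume) {B : ℝ≥0∞}
    (h : ∀ u : ℂ, ‖u‖ = 1 → eLpNorm (fun x => (u * F x).re) (ENNReal.ofReal p) volume ≤ B) :
    eLpNorm F (ENNReal.ofReal p) volume ≤ ENNReal.ofReal (Real.sqrt 2) * B := by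
  have hsq : ∀ {E : Type} [NormedAddCommGroup E] (g : ℂ → E),
      eLpNorm (fun x => ‖g x‖ ^ (2 : ℝ)) (ENNReal.ofReal (p / 2)) volume =
        eLpNorm g (ENNReal.ofReal p) volume ^ (2 : ℝ) := by
    intro E _ g
    rw [eLpNorm_norm_rpow g two_pos, ← ENNReal.ofReal_mul (by linarith), div_mul_cancel₀ _ two_ne_zero]
  have h1 := h 1 norm_one
  have h2 := h (-Complex.I) (by simp)
  have m1 : AEStronglyMeasurable (fun x => (1 * F x).re) volume :=
    Complex.continuous_re.comp_aestronglyMeasurable (hF.const_mul 1)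
  have m2 : AEStronglyMeasurable (fun x => (-Complex.I * F x).re) volume :=
    Complex.continuous_re.comp_aestronglyMeasurable (hF.const_mul _)
  have key : eLpNorm F (ENNReal.ofReal p) volume ^ (2 : ℝ) ≤
      (ENNReal.ofReal (Real.sqrt 2) * B) ^ (2 : ℝ) := by
    rw [← hsq F]
    have e : (fun x => ‖F x‖ ^ (2 : ℝ)) = (fun x => ‖(1 * F x).re‖ ^ (2 : ℝ)) +
        fun x => ‖(-Complex.I * F x).re‖ ^ (2 : ℝ) := by
      ext x
      simp only [Pi.add_apply, Real.rpow_two, Real.norm_eq_abs, sq_abs]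
      rw [Complex.sq_norm, Complex.normSq_apply]
      simp
      ring
    rw [e]
    refine (eLpNorm_add_le ((Real.continuous_rpow_const two_pos.le).comp_aestronglyMeasurable m1.norm)
      ((Real.continuous_rpow_const two_pos.le).comp_aestronglyMeasurable m2.norm)
      (by rw [← ENNReal.ofReal_one]; exact ENNReal.ofReal_le_ofReal (by linarith))).trans ?_
    rw [hsq, hsq, ENNReal.mul_rpow_of_nonneg _ _ two_pos.le,
      ENNReal.ofReal_rpow_of_nonneg (Real.sqrt_nonneg 2) two_pos.le, Real.rpow_two, Real.sq_sqrt two_pos.le,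
      ENNReal.ofReal_ofNat, two_mul]
    gcongr
  exact (ENNReal.rpow_le_rpow_iff two_pos).1 key

lemma enorm_integral_mul_le {p : ℝ} (hp : 2 ≤ p) {F : ℂ → ℂ} {g : ℂ → ℝ}
    (hF : MemLp F (ENNReal.ofReal p) volume)
    (hg : MemLp g (ENNReal.ofReal (p / (p - 1))) volume) {B : ℝ≥0∞}
    (h : ∀ u : ℂ, ‖u‖ = 1 → eLpNorm (fun x => (u * F x).re) (ENNReal.ofReal p) volume ≤ B) :
    Integrable (fun z => F z * (g z : ℂ)) volume ∧
      ‖∫ z, F z * (g z : ℂ)‖ₑ ≤ B * eLpNorm g (ENNReal.ofReal (p / (p - 1))) volume := by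
  have := (holderConjugate_div_sub_one hp).symm
  have hint : Integrable (fun z => F z * (g z : ℂ)) volume := hF.integrable_mul hg.ofReal
  refine ⟨hint, ?_⟩
  -- This `u` rotates the integral to its modulus. As `g` is real, only `Re(uF)` then contributes,
  -- so Hölder's inequality loses no `√2`.
  obtain ⟨u, hu, hu'⟩ : ∃ u : ℂ, ‖u‖ = 1 ∧ u * ∫ z, F z * (g z : ℂ) = ‖∫ z, F z * (g z : ℂ)‖ := by
    set w := ∫ z, F z * (g z : ℂ)
    by_cases hw : w = 0
    · exact ⟨1, norm_one, by simp [hw]⟩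
    · have hw' : (‖w‖ : ℂ) ≠ 0 := by exact_mod_cast norm_ne_zero_iff.2 hw
      refine ⟨starRingEnd ℂ w / ‖w‖, ?_, ?_⟩
      · rw [norm_div, Complex.norm_conj, Complex.norm_real, norm_norm, div_self (norm_ne_zero_iff.2 hw)]
      · rw [div_mul_eq_mul_div, Complex.conj_mul', pow_two, mul_div_assoc, div_self hw', mul_one]
  have hre : ‖∫ z, F z * (g z : ℂ)‖ = ∫ z, (u * F z).re * g z := by
    rw [← Complex.ofReal_re ‖_‖, ← hu', ← integral_const_mul]
    refine (integral_re (𝕜 := ℂ) (hint.const_mul u)).symm.trans (integral_congr_ae ?_)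
    refine Eventually.of_forall fun z => ?_
    simp only [RCLike.re_eq_complex_re]
    rw [← mul_assoc, Complex.re_mul_ofReal]
  have m1 : AEStronglyMeasurable (fun x => (u * F x).re) volume :=
    Complex.continuous_re.comp_aestronglyMeasurable (hF.1.const_mul u)
  rw [← enorm_norm, hre]
  refine (enorm_integral_le_lintegral_enorm _).trans ?_
  rw [← eLpNorm_one_eq_lintegral_enorm]
  refine (eLpNorm_smul_le_mul_eLpNorm (r := 1) (p := ENNReal.ofReal p)
    (q := ENNReal.ofReal (p / (p - 1))) hg.1 m1).trans ?_
  gcongr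
  exact h u hu

theorem theorem3p3 (p : ℝ) (hp : 2 ≤ p) :
    (∀ f : ℂ → ℝ, MemLp f (ENNReal.ofReal p) volume →
      (∀ᵐ z : ℂ, AhlforsBeurlingExistsAt (fun ζ => (f ζ : ℂ)) z) ∧
      MemLp (ahlforsBeurling (fun ζ => (f ζ : ℂ))) (ENNReal.ofReal p) volume ∧
      eLpNorm (ahlforsBeurling (fun ζ => (f ζ : ℂ))) (ENNReal.ofReal p) volume ≤
        ENNReal.ofReal (Real.sqrt 2 * (p - 1)) * eLpNorm f (ENNReal.ofReal p) volume) ∧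
    (∀ f g : ℂ → ℝ, MemLp f (ENNReal.ofReal p) volume →
      MemLp g (ENNReal.ofReal (p / (p - 1))) volume →
      Integrable (fun z => ahlforsBeurling (fun ζ => (f ζ : ℂ)) z * (g z : ℂ)) volume ∧
      ‖∫ z : ℂ, ahlforsBeurling (fun ζ => (f ζ : ℂ)) z * (g z : ℂ)‖ₑ ≤
        ENNReal.ofReal (p - 1) * eLpNorm f (ENNReal.ofReal p) volume *
          eLpNorm g (ENNReal.ofReal (p / (p - 1))) volume) := by
  constructor
  · intro f hf
    obtain ⟨F, hF, hbound, hae⟩ := exists_beurling_transform hp hf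
    have hFae : ahlforsBeurling (fun ζ => (f ζ : ℂ)) =ᵐ[volume] F := hae.mono fun z hz => hz.2
    refine ⟨hae.mono fun z hz => hz.1, (memLp_congr_ae hFae).2 hF, ?_⟩
    rw [eLpNorm_congr_ae hFae, ENNReal.ofReal_mul (Real.sqrt_nonneg 2), mul_assoc]
    exact eLpNorm_le_sqrt_two_mul hp hF.1 hbound
  · intro f g hf hg
    obtain ⟨F, hF, hbound, hae⟩ := exists_beurling_transform hp hf
    have hFg : (fun z => ahlforsBeurling (fun ζ => (f ζ : ℂ)) z * (g z : ℂ)) =ᵐ[volume]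
        fun z => F z * (g z : ℂ) := hae.mono fun z hz => by simp only [hz.2]
    rw [integral_congr_ae hFg, integrable_congr hFg]
    exact enorm_integral_mul_le hp hF hg hbound
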